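/- Let $\alpha$ be irrational with bounded partial quotients: $\alpha=[a_0;a_1,a_2,\dots]$ and $C:=\sup_{i\ge1}a_i+1<\infty$. Let $T x=x+\alpha$ on $\mathbb T=\mathbb R/\mathbb Z$. Let $f:\mathbb T\to\mathbb R$ be a left-continuous function of bounded variation with $f\ge c$ for some constant $c>0$, whose Lebesgue decomposition has no singular continuous part; that is, on $[0,1]$ (with $f(1):=f(1^-)$) the function $f(x)-\sum_{0\le y<x}(f(y^+)-f(y^-))$ is absolutely continuous. Let $(\beta_i)_{i\ge1}$ be an enumeration, without repetition, of points of $\mathbb T$ containing all discontinuities of $f$ (points of continuity are allowed), let $d_i:=f(\beta_i^-)-f(\beta_i^+)$, and let $S:=\sum_i d_i$ be the sum of the jumps (so $S=\int_{\mathbb T}f'\,d\lambda$). Assume $S\neq0$, and assume that for some $j\in\mathbb N$ and some $\theta>0$ $$\sum_{i>j}|d_i|\le\frac{|S|}{(2+\theta)(2C+1)\big((2C+1)^j+1\big)}.$$ Put $D:=\{\sum_{i\ge1}n_id_i:\ n_i\in\mathbb Z,\ 0\le n_i<2C+1\}$. Then there are $p\in\mathbb R$ and $\eta>0$ with $(p-\eta,p+\eta)\subset(0,|S|)\setminus(D\cup-D)$.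 For every such $p$, with $$P:=\overline{(\operatorname{sgn}S)\,p-D},$$ the special flow $\mathcal T^f=(T^f_t)_{t\in\mathbb R}$ over $T$ under $f$ has the property $R(\gamma,P\cup(-P))$ for every $\gamma>0$. Here $\mathcal T^f$ acts on $X^f=\{(x,s)\in\mathbb T\times\mathbb R:0\le s<f(x)\}$ by $T^f_t(x,s)=(T^nx,\,s+t-f^{(n)}(x))$, where $f^{(n)}$ $(n\in\mathbb Z)$ is the additive cocycle over $T$ generated by $f$ (so $f^{(n)}=\sum_{0\le i<n}f\circ T^i$ for $n\ge0$) and $n\in\mathbb Z$ is the unique integer with $f^{(n)}(x)\le s+t<f^{(n+1)}(x)$. The space $X^f$ carries the metric $d_1((x,s),(y,t))=d(x,y)+|s-t|$ and the normalized restriction of Lebesgue measure. For a flow $(S_t)$ on a metric space $(X,d)$ with a Borel probability measure $\mu$, $t_0\ne0$ and a compact $Q\subset\mathbb R\setminus\{0\}$, the property $R(t_0,Q)$ means: for every $\varepsilon>0$ there is $\kappa=\kappa(\varepsilon)>0$ such that for every $N\in\mathbb N$ there are $\delta>0$ and a Borel set $Z$ with $\mu(Z)>1-\varepsilon$ such that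 for all $x,x'\in Z$ with $x'$ not in the orbit of $x$ and $d(x,x')<\delta$ there are positive integers $M,L\ge N$ with $L/M\ge\kappa$ and $\rho\in Q$ with $$\frac1L\Big|\big\{n\in\mathbb Z\cap[M,M+L]:\ d\big(S_{nt_0}(x),S_{nt_0+\rho}(x')\big)<\varepsilon\big\}\Big|>1-\varepsilon .$$ -/

import Mathlib

open Set Filter Topology MeasureTheory

noncomputable section

namespace SpecialFlowRatner

/-! ### Special flows -/

section Flow

variable {X : Type*}

/-- The cocycle `f^{(m)}`, `m : ℤ`, generated by `f` over an invertible map `T`: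
`f x + ⋯ + f (T^(m-1) x)` for `m ≥ 0` and `-(f (T^m x) + ⋯ + f (T^(-1) x))` for `m < 0`. -/
def cocycle (T : Equiv.Perm X) (f : X → ℝ) : ℤ → X → ℝ
  | Int.ofNat n, x => ∑ i ∈ Finset.range n, f ((T ^ i) x)
  | Int.negSucc n, x => -∑ i ∈ Finset.range (n + 1), f ((T ^ (-((i : ℤ) + 1))) x)

theorem cocycle_succ (T : Equiv.Perm X) (f : X → ℝ) (m : ℤ) (x : X) :
    cocycle T f (m + 1) x = cocycle T f m x + f ((T ^ m) x) := by
  rcases m with n | n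
  · have h : Int.ofNat n + 1 = Int.ofNat (n + 1) := rfl
    rw [h]
    simp [cocycle, Finset.sum_range_succ]
  · rcases n with _ | n
    · have h : Int.negSucc 0 + 1 = Int.ofNat 0 := rfl
      rw [h]
      simp [cocycle]
    · have h : Int.negSucc (n + 1) + 1 = Int.negSucc n := by omega
      have h2 : (Int.negSucc (n + 1)) = -(((n + 1 : ℕ) : ℤ) + 1) := by omega
      rw [h]
      simp only [cocycle]
      rw [Finset.sum_range_succ _ (n + 1), h2]
      ring

/-- The phase space `X^f = {(x, s) : 0 ≤ s < f x}`. -/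
def Space (f : X → ℝ) : Type _ := {q : X × ℝ // 0 ≤ q.2 ∧ q.2 < f q.1}

/-- The special flow over `T` under `f`: `(x, s) ↦ (T^n x, s + t - f^{(n)} x)`, where `n : ℤ` is
such that `f^{(n)} x ≤ s + t < f^{(n+1)} x` (there is exactly one such `n` when `f` is bounded
away from zero). -/
def specialFlow (T : Equiv.Perm X) (f : X → ℝ) (t : ℝ) (q : Space f) : Space f := by
  classical
  exact
    if h : ∃ n : ℤ, cocycle T f n q.1.1 ≤ q.1.2 + t ∧ q.1.2 + t < cocycle T f (n + 1) q.1.1 then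
      ⟨((T ^ h.choose) q.1.1, q.1.2 + t - cocycle T f h.choose q.1.1), by
        have h1 := h.choose_spec
        rw [cocycle_succ] at h1
        constructor
        · exact sub_nonneg.2 h1.1
        · exact sub_lt_iff_lt_add'.2 h1.2⟩
    else q

/-- The metric `d₁((x, s), (y, t)) = d(x, y) + |s - t|` on `X^f`. -/
instance instMetricSpaceSpace [MetricSpace X] (f : X → ℝ) : MetricSpace (Space f) where
  dist p q := dist p.1.1 q.1.1 + |p.1.2 - q.1.2|
  dist_self p := by simp
  dist_comm p q := by rw [dist_comm, abs_sub_comm]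
  dist_triangle p q r := by
    have h1 := dist_triangle p.1.1 q.1.1 r.1.1
    have h2 := abs_sub_le p.1.2 q.1.2 r.1.2
    linarith
  eq_of_dist_eq_zero {p q} h := by
    have h1 : 0 ≤ dist p.1.1 q.1.1 := dist_nonneg
    have h2 := abs_nonneg (p.1.2 - q.1.2)
    have h3 : dist p.1.1 q.1.1 = 0 := by linarith
    have h4 : |p.1.2 - q.1.2| = 0 := by linarith
    exact Subtype.ext (Prod.ext (dist_eq_zero.1 h3) (sub_eq_zero.1 (abs_eq_zero.1 h4)))

/-- The restriction to `X^f` of the product σ-algebra. -/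
instance instMeasurableSpaceSpace [MeasurableSpace X] (f : X → ℝ) : MeasurableSpace (Space f) :=
  MeasurableSpace.comap (fun q : Space f => q.1) inferInstance

theorem isInducing_val [MetricSpace X] (f : X → ℝ) :
    IsInducing (fun q : Space f => q.1) := by
  have hl : LipschitzWith 1 (fun q : Space f => q.1) := by
    refine LipschitzWith.of_dist_le_mul fun p q => ?_
    have h1 : 0 ≤ dist p.1.1 q.1.1 := dist_nonneg
    have h2 := abs_nonneg (p.1.2 - q.1.2)
    have h3 : dist p q = dist p.1.1 q.1.1 + |p.1.2 - q.1.2| := rfl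
    rw [Prod.dist_eq, Real.dist_eq, h3]
    simp only [NNReal.coe_one, one_mul]
    exact max_le (by linarith) (by linarith)
  have ha : AntilipschitzWith 2 (fun q : Space f => q.1) := by
    refine AntilipschitzWith.of_le_mul_dist fun p q => ?_
    have h3 : dist p q = dist p.1.1 q.1.1 + |p.1.2 - q.1.2| := rfl
    have h4 := le_max_left (dist p.1.1 q.1.1) |p.1.2 - q.1.2|
    have h5 := le_max_right (dist p.1.1 q.1.1) |p.1.2 - q.1.2|
    rw [Prod.dist_eq, Real.dist_eq, h3]
    simp only [NNReal.coe_ofNat]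
    linarith
  exact (ha.isUniformInducing hl.uniformContinuous).isInducing

instance instBorelSpaceSpace [MetricSpace X] [SecondCountableTopology X] [MeasurableSpace X]
    [BorelSpace X] (f : X → ℝ) : BorelSpace (Space f) := by
  refine ⟨?_⟩
  rw [(isInducing_val f).eq_induced, borel_comap, ← BorelSpace.measurable_eq (α := X × ℝ)]
  rfl

/-- The restriction of `μ × Lebesgue` to `X^f`. -/
def restrictedMeasure [MeasureSpace X] (f : X → ℝ) : Measure (Space f) :=
  Measure.comap (fun q : Space f => q.1) (volume : Measure (X × ℝ))

/-- The invariant measure of the special flow, normalized to total mass one. -/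
def flowMeasure [MeasureSpace X] (f : X → ℝ) : Measure (Space f) :=
  (restrictedMeasure f univ)⁻¹ • restrictedMeasure f

end Flow

/-! ### The property `R(t₀, P)` -/

/-- The property `R(t₀, P)` of a flow `S` on a metric space with a Borel probability measure `μ`,
for a compact `P ⊆ ℝ \ {0}` and `t₀ ≠ 0`. Here `κ` depends on `ε` only, while `δ` and `Z` depend
on `ε` and `N`. -/
def RatnerProperty {X : Type*} [MetricSpace X] [MeasurableSpace X] [BorelSpace X]
    (S : ℝ → X → X) (μ : Measure X) (t₀ : ℝ) (P : Set ℝ) : Prop :=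
  t₀ ≠ 0 ∧ IsCompact P ∧ 0 ∉ P ∧
  ∀ ε : ℝ, 0 < ε → ∃ κ : ℝ, 0 < κ ∧ ∀ N : ℕ, ∃ δ : ℝ, 0 < δ ∧
    ∃ Z : Set X, MeasurableSet Z ∧ ENNReal.ofReal (1 - ε) < μ Z ∧
      ∀ x ∈ Z, ∀ x' ∈ Z, (∀ t : ℝ, S t x ≠ x') → dist x x' < δ →
        ∃ M L : ℕ, N ≤ M ∧ N ≤ L ∧ 0 < M ∧ 0 < L ∧ κ ≤ (L : ℝ) / M ∧
          ∃ ρ ∈ P,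
            1 - ε < (1 / (L : ℝ)) *
              (Set.ncard {n : ℤ | (M : ℤ) ≤ n ∧ n ≤ M + L ∧
                dist (S (n * t₀) x) (S (n * t₀ + ρ) x') < ε} : ℝ)

/-! ### Roof functions on the circle -/

/-- The periodic lift to `ℝ` of a function on the circle `ℝ / ℤ`. -/
def lift (f : UnitAddCircle → ℝ) (x : ℝ) : ℝ := f (x : UnitAddCircle)

/-- The jump of `f` at the point `y mod 1`, with the sign for which the sum of all the jumps
is `∫ f'` if `f` has no singular continuous part (`{· - β}` has the jump `1` at `β`). -/
def jump (f : UnitAddCircle → ℝ) (y : ℝ) : ℝ :=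
  Function.leftLim (lift f) y - Function.rightLim (lift f) y

/-- The jump part `x ↦ ∑_{0 ≤ y < x} (f(y⁺) - f(y⁻))` of `f` on `[0, 1]`. -/
def jumpPart (f : UnitAddCircle → ℝ) (x : ℝ) : ℝ :=
  ∑' y : Set.Ico (0 : ℝ) x, -jump f y

/-- The sum `S` of the jumps of `f`. -/
def sumJumps (f : UnitAddCircle → ℝ) : ℝ :=
  ∑' y : Set.Ico (0 : ℝ) 1, jump f y

/-- The class `𝒱` of (left-continuous) functions of bounded variation on the circle whose
Lebesgue decomposition on `[0, 1]` has no singular continuous part: the function minus its jump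
part is absolutely continuous. -/
structure MemV (f : UnitAddCircle → ℝ) : Prop where
  boundedVariation : BoundedVariationOn (lift f) (Set.Icc 0 1)
  leftContinuous : ∀ x : ℝ, ContinuousWithinAt (lift f) (Set.Iic x) x
  noSingularPart : AbsolutelyContinuousOnInterval (fun x => lift f x - jumpPart f x) 0 1

/-- The class `𝒰` of functions in `𝒱` with non-zero sum of jumps. -/
def MemU (f : UnitAddCircle → ℝ) : Prop := MemV f ∧ sumJumps f ≠ 0

/-- `β` lists, without repetition, points of `[0, 1)`, among them all the discontinuities of `f`.
(Points of continuity, which have jump zero, may occur in the list.) -/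
def ListsDiscontinuities (f : UnitAddCircle → ℝ) (β : ℕ → ℝ) : Prop :=
  (∀ i, β i ∈ Set.Ico (0 : ℝ) 1) ∧ Function.Injective β ∧
    ∀ y ∈ Set.Ico (0 : ℝ) 1, ¬ ContinuousAt (lift f) y → y ∈ Set.range β

/-- The set of all sums `∑ nᵢ dᵢ` with integers `0 ≤ nᵢ < 2C + 1`. -/
def jumpSums (C : ℝ) (d : ℕ → ℝ) : Set ℝ :=
  {r | ∃ n : ℕ → ℕ, (∀ i, (n i : ℝ) < 2 * C + 1) ∧ HasSum (fun i => (n i : ℝ) * d i) r}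

/-- The set `P = closure ((sgn S) p - D)`. -/
def shiftSet (S p : ℝ) (D : Set ℝ) : Set ℝ :=
  closure ((fun x => Real.sign S * p - x) '' D)

/-! ### Continued fractions -/

/-- The partial quotient `a_{n+1}` of `α = [a₀; a₁, a₂, …]` (`α` irrational). -/
def partialQuotient (α : ℝ) (n : ℕ) : ℝ :=
  ((GenContFract.of α).partDens.get? n).getD 0

/-- `C = sup {a₁, a₂, …} + 1`. -/
def cfConst (α : ℝ) : ℝ := (⨆ n, partialQuotient α n) + 1

end SpecialFlowRatner

end

/-! Write `x' = x + τ` with `τ > 0` small. Off its jumps `f` is a primitive of an integrable `f'`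
with `∫ f' = S`, so `f^(k)(x') - f^(k)(x)` is the sum of three terms: a drift `kτS`, an
equidistribution error for `f'`, and `-∑ N_i(k) d_i`, where `N_i(k)` counts the visits of the moving
arc `[x, x + τ) + lα`, `l < k`, to `β_i` (`cocycle_sub_cocycle`). Only `k ≤ 1/τ` matters. There
bounded partial quotients give `N_i(k) < 2C + 1` (`one_le_mul_abs_sub`, `arcCount_lt`), and the
error tends to `0` with `τ`, uniformly in `x` and `k` (`exists_abs_arcError_le`): it is `O(τ)` for
trigonometric polynomials, bounded by the L¹ norm in general, and the former are dense.

Look at those `k` for which `kτ|S|` lies just below `p`. They form an interval of length comparable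
to `1/τ`. The finitely many counts that carry almost all the jumps are monotone and bounded, so the
interval has a block, of length a fixed proportion of `1/τ`, on which they are all constant. There
the difference stays close to `ρ = sgn(S) p - r` with `r ∈ D` (`exists_window_cocycle_sub`). If `x'`
lies on the other side of `x`, exchange the points; the shift is then `-ρ`. The gap around `p` keeps
`P` away from `0`.

In the flow, such a block of return counts is a block of times `nγ` in `[M, M + L]` with `L/M`
bounded below (`exists_time_window`). During it the orbit of the second point, delayed by `ρ`,
follows that of the first, except when the latter is close to the floor or the roof
(`dist_specialFlow_lt`). That exceptional set has small measure. Since the time-`γ` map need not be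
ergodic, its rare visits along all long windows come from the mean ergodic theorem, whose limit is
an invariant function, together with the maximal inequality (`exists_birkhoffSum_indicator_le`).

The number `p` exists by measure: `D ∪ -D` is covered by finitely many closed intervals of total
length less than `|S|` (`exists_Ioo_subset_diff_jumpSums`). -/

noncomputable section

namespace SpecialFlowRatner

/-! ### Badly approximable numbers -/

section Diophantine

theorem exists_stream_contsAux {α : ℝ} (hα : Irrational α) (n : ℕ) :
    ∃ (r : GenContFract.IntFractPair ℝ) (A' B' A B : ℤ),
      GenContFract.IntFractPair.stream α n = some r ∧ Irrational r.fr ∧ 0 < r.fr ∧ r.fr < 1 ∧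
      -- `contsAux` is shifted by one: `A / B` is the `n`-th convergent and `A', B'` belong to the
      -- preceding one. Irrationality keeps the expansion from terminating.
      (GenContFract.of α).contsAux n = ⟨A', B'⟩ ∧ (GenContFract.of α).contsAux (n + 1) = ⟨A, B⟩ ∧
      0 ≤ B' ∧ B' ≤ B ∧ 1 ≤ B ∧ |A' * B - B' * A| = 1 := by
  have hpos : ∀ {m : ℕ} {r : GenContFract.IntFractPair ℝ},
      GenContFract.IntFractPair.stream α m = some r → Irrational r.fr → 0 < r.fr ∧ r.fr < 1 := by
    intro m r h1 h2
    have h3 := GenContFract.IntFractPair.nth_stream_fr_nonneg_lt_one h1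
    exact ⟨lt_of_le_of_ne h3.1 (Ne.symm h2.ne_zero), h3.2⟩
  induction n with
  | zero =>
    have h0 := GenContFract.IntFractPair.stream_zero α
    have h1 : Irrational (GenContFract.IntFractPair.of α).fr := by
      change Irrational (Int.fract α)
      rw [← Int.self_sub_floor]
      exact hα.sub_intCast _
    refine ⟨_, 1, 0, ⌊α⌋, 1, h0, h1, (hpos h0 h1).1, (hpos h0 h1).2, ?_, ?_, le_rfl, zero_le_one,
      le_rfl, by simp⟩
    · simp
    · simp
  | succ n ih =>
    obtain ⟨r, A', B', A, B, h0, hirr, hr0, hr1, hc, hc', hB', hBB, hB, hdet⟩ := ih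
    have h1 := GenContFract.IntFractPair.stream_succ_of_some h0 hr0.ne'
    have h2 := GenContFract.get?_of_eq_some_of_get?_intFractPair_stream_fr_ne_zero h0 hr0.ne'
    have h3 : Irrational (GenContFract.IntFractPair.of r.fr⁻¹).fr := by
      change Irrational (Int.fract r.fr⁻¹)
      rw [← Int.self_sub_floor]
      exact (irrational_inv_iff.2 hirr).sub_intCast _
    have hb : (1 : ℤ) ≤ (GenContFract.IntFractPair.of r.fr⁻¹).b :=
      GenContFract.IntFractPair.one_le_succ_nth_stream_b h1
    set b := (GenContFract.IntFractPair.of r.fr⁻¹).b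
    refine ⟨_, A, B, b * A + A', b * B + B', h1, h3, (hpos h1 h3).1, (hpos h1 h3).2, hc', ?_,
      by omega, by nlinarith, by nlinarith, ?_⟩
    · rw [GenContFract.contsAux_recurrence h2 hc hc']
      simp
    · rw [← hdet, ← abs_neg]
      congr 1
      ring

theorem partialQuotient_eq_floor {α : ℝ} {n : ℕ} {r : GenContFract.IntFractPair ℝ}
    (h : GenContFract.IntFractPair.stream α n = some r) (hr : r.fr ≠ 0) :
    partialQuotient α n = ⌊r.fr⁻¹⌋ := by
  have h2 := GenContFract.get?_of_eq_some_of_get?_intFractPair_stream_fr_ne_zero h hr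
  rw [partialQuotient, GenContFract.partDen_eq_s_b h2]
  rfl

theorem partialQuotient_le_cfConst {α : ℝ} (hb : BddAbove (Set.range (partialQuotient α)))
    (n : ℕ) : partialQuotient α n + 1 ≤ cfConst α := by
  have := le_ciSup hb n
  unfold cfConst
  linarith

theorem two_le_cfConst {α : ℝ} (hα : Irrational α)
    (hb : BddAbove (Set.range (partialQuotient α))) : 2 ≤ cfConst α := by
  obtain ⟨r, A', B', A, B, h0, hirr, hr0, hr1, -⟩ := exists_stream_contsAux hα 0
  have h1 := partialQuotient_eq_floor h0 hr0.ne'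
  have h2 := partialQuotient_le_cfConst hb 0
  have h3 : (1 : ℝ) ≤ (⌊r.fr⁻¹⌋ : ℝ) := by
    exact_mod_cast Int.le_floor.2 (by simpa using (one_le_inv₀ hr0).2 hr1.le)
  linarith

/-- A number with bounded partial quotients is badly approximable. -/
theorem one_le_mul_abs_sub {α : ℝ} (hα : Irrational α)
    (hb : BddAbove (Set.range (partialQuotient α))) {m : ℕ} (hm : 0 < m) (k : ℤ) :
    1 ≤ 2 * cfConst α * m * |m * α - k| := by
  have hC := two_le_cfConst hα hb
  set C := cfConst α
  have hm' : (0 : ℝ) < m := by exact_mod_cast hm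
  by_contra! hlt
  have habs : |m * α - k| = m * |α - k / m| := by
    rw [← abs_of_pos hm', ← abs_mul, abs_of_pos hm']
    congr 1
    field_simp
  rw [habs] at hlt
  -- Legendre's criterion: so good an approximation is a convergent. The criterion is stated for the
  -- reduced denominator, which is at most `m`.
  have hq : |α - ((k / m : ℚ) : ℝ)| < 1 / (2 * (((k / m : ℚ).den : ℝ)) ^ 2) := by
    have hden : (((k / m : ℚ).den : ℝ)) ≤ m := by
      have h := Rat.den_dvd k m
      have h' := Int.le_of_dvd (by exact_mod_cast hm) h
      simp only [Rat.divInt_eq_div, Int.cast_natCast] at h'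
      exact_mod_cast h'
    have hden0 : (0 : ℝ) < ((k / m : ℚ).den : ℝ) := by exact_mod_cast (k / m : ℚ).den_pos
    rw [lt_div_iff₀ (by positivity)]
    have h1 : |α - ((k / m : ℚ) : ℝ)| = |α - k / m| := by push_cast; rfl
    rw [h1]
    have h2 : |α - k / m| * (2 * ((k / m : ℚ).den : ℝ) ^ 2) ≤ |α - k / m| * (2 * (m : ℝ) ^ 2) := by
      gcongr
    have h3 : 0 ≤ |α - k / m| * (m : ℝ) ^ 2 := by positivity
    nlinarith
  obtain ⟨n, hn⟩ := Real.exists_convs_eq_rat hq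
  obtain ⟨r, A', B', A, B, h0, hirr, hr0, hr1, hc, hc', hB', hBB, hB, hdet⟩ :=
    exists_stream_contsAux hα n
  have hpq := partialQuotient_eq_floor h0 hr0.ne'
  have hpC := partialQuotient_le_cfConst hb n
  have hsub := GenContFract.sub_convs_eq h0
  have hconv : (GenContFract.of α).convs n = A / B := by
    rw [GenContFract.conv_eq_conts_a_div_conts_b, GenContFract.nth_cont_eq_succ_nth_contAux, hc']
  simp only [hc, hc', if_neg hr0.ne', hn] at hsub
  rw [hconv] at hn
  have hBR : (1 : ℝ) ≤ B := by exact_mod_cast hB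
  have hBR' : (0 : ℝ) ≤ B' := by exact_mod_cast hB'
  have hBBR : (B' : ℝ) ≤ B := by exact_mod_cast hBB
  have hAk : (A : ℝ) * m = k * B := by
    push_cast at hn
    field_simp at hn
    linarith
  have hAk' : A * m = k * B := by exact_mod_cast hAk
  -- The determinant `±1` makes `A` and `B` coprime, so `A m = k B` forces `B ∣ m`.
  have hBm : (B : ℝ) ≤ m := by
    have h1 : B ∣ (m : ℤ) := by
      have h2 : B * (A' * m - B' * k) = (A' * B - B' * A) * m := by linear_combination B' * hAk'
      rcases (abs_eq zero_le_one).1 hdet with h | h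
      · rw [h, one_mul] at h2
        exact ⟨_, h2.symm⟩
      · rw [h] at h2
        exact ⟨-(A' * m - B' * k), by linarith⟩
    exact_mod_cast Int.le_of_dvd (by exact_mod_cast hm) h1
  have hinv : r.fr⁻¹ < C := by
    have := Int.lt_floor_add_one r.fr⁻¹
    linarith
  have hinv0 : 0 < r.fr⁻¹ := inv_pos.2 hr0
  have hD : (B : ℝ) * (r.fr⁻¹ * B + B') ≤ (C + 1) * m ^ 2 := by
    calc (B : ℝ) * (r.fr⁻¹ * B + B') ≤ B * (C * B + B) := by gcongr
      _ = (C + 1) * B ^ 2 := by ring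
      _ ≤ (C + 1) * m ^ 2 := by gcongr
  have hval : |α - k / m| = 1 / (B * (r.fr⁻¹ * B + B')) := by
    have h1 : |α - k / m| = |α - ((k / m : ℚ) : ℝ)| := by push_cast; rfl
    rw [h1, hsub, abs_div, abs_pow, abs_neg, abs_one, one_pow, abs_of_pos (by positivity)]
  have hDpos : 0 < (B : ℝ) * (r.fr⁻¹ * B + B') := by positivity
  -- The exact error of a convergent gives the constant `C + 1`, which is at most `2C`; this
  -- contradicts the assumption.
  have hlow : 1 ≤ (C + 1) * m ^ 2 * |α - k / m| := by
    rw [hval, mul_one_div, le_div_iff₀ hDpos]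
    linarith
  have h3 : 0 ≤ |α - k / m| * (m : ℝ) ^ 2 := by positivity
  nlinarith

end Diophantine

/-! ### Visits of a small set along windows of an orbit -/

section Ergodic

variable {X : Type*} {T : X → X}

/-- The maximum of `0` and of the Birkhoff sums of `w` of length at most `N`. -/
def maxSum (T : X → X) (w : X → ℝ) : ℕ → X → ℝ
  | 0 => fun _ => 0
  | N + 1 => fun x => max 0 (w x + maxSum T w N (T x))

theorem maxSum_nonneg (w : X → ℝ) (N : ℕ) (x : X) : 0 ≤ maxSum T w N x := by
  cases N with
  | zero => exact le_rfl
  | succ N => exact le_max_left _ _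

theorem maxSum_le_succ (w : X → ℝ) (N : ℕ) (x : X) : maxSum T w N x ≤ maxSum T w (N + 1) x := by
  induction N generalizing x with
  | zero => exact le_max_left _ _
  | succ N ih =>
    change max 0 _ ≤ max 0 _
    have := ih (T x)
    gcongr

theorem birkhoffSum_le_maxSum (w : X → ℝ) (N : ℕ) (x : X) :
    birkhoffSum T w N x ≤ maxSum T w N x := by
  induction N generalizing x with
  | zero => simp [maxSum]
  | succ N ih =>
    rw [birkhoffSum_succ']
    refine le_trans ?_ (le_max_right _ _)
    have := ih (T x)
    gcongr

variable [MeasurableSpace X] {μ : Measure X}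

theorem measurable_maxSum (hT : Measurable T) {w : X → ℝ} (hw : Measurable w) (N : ℕ) :
    Measurable (maxSum T w N) := by
  induction N with
  | zero => exact measurable_const
  | succ N ih => exact measurable_const.max (hw.add (ih.comp hT))

theorem integrable_maxSum (hT : MeasurePreserving T μ μ) {w : X → ℝ} (hw : Integrable w μ) (N : ℕ) :
    Integrable (maxSum T w N) μ := by
  induction N with
  | zero => exact integrable_zero _ _ _
  | succ N ih =>
    exact (integrable_zero _ _ _).sup (hw.add (hT.integrable_comp_of_integrable ih))

/-- The maximal ergodic theorem. -/
theorem setIntegral_maxSum_nonneg (hT : MeasurePreserving T μ μ) {w : X → ℝ}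
    (hwm : Measurable w) (hw : Integrable w μ) (N : ℕ) :
    0 ≤ ∫ x in {x | 0 < maxSum T w N x}, w x ∂μ := by
  cases N with
  | zero => simp [maxSum]
  | succ N =>
    set F := maxSum T w (N + 1) with hF
    have hFi : Integrable F μ := integrable_maxSum hT hw _
    have hFm : Measurable F := measurable_maxSum hT.measurable hwm _
    have hFTi : Integrable (fun x => F (T x)) μ := hT.integrable_comp_of_integrable hFi
    have hA : MeasurableSet {x | 0 < F x} := measurableSet_lt measurable_const hFm
    -- Garsia's argument: where `F > 0` the maximum is not the trivial `0`, so `F ≤ w + F ∘ T`. By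
    -- invariance `F - F ∘ T` has nonnegative integral there, as `F` vanishes elsewhere and `F ∘ T ≥
    -- 0`.
    have h1 : ∫ x in {x | 0 < F x}, (F x - F (T x)) ∂μ ≤ ∫ x in {x | 0 < F x}, w x ∂μ := by
      refine setIntegral_mono_on (hFi.sub hFTi).integrableOn hw.integrableOn hA fun x hx => ?_
      have h2 : F x = max 0 (w x + maxSum T w N (T x)) := rfl
      have h3 : maxSum T w N (T x) ≤ F (T x) := maxSum_le_succ w N (T x)
      have hx' : 0 < F x := hx
      rcases max_cases 0 (w x + maxSum T w N (T x)) with h | h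
      · rw [h2, h.1] at hx'
        exact absurd hx' (lt_irrefl _)
      · rw [h2, h.1]
        linarith
    refine le_trans ?_ h1
    rw [integral_sub hFi.integrableOn hFTi.integrableOn, sub_nonneg]
    have h4 : ∫ x in {x | 0 < F x}, F x ∂μ = ∫ x, F x ∂μ := by
      refine setIntegral_eq_integral_of_forall_compl_eq_zero fun x hx => ?_
      exact le_antisymm (not_lt.1 hx) (maxSum_nonneg w _ x)
    have h5 : ∫ x, F (T x) ∂μ = ∫ x, F x ∂μ := by
      have h6 := integral_map (μ := μ) hT.measurable.aemeasurable
        (f := F) (by rw [hT.map_eq]; exact hFi.aestronglyMeasurable)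
      rw [hT.map_eq] at h6
      exact h6.symm
    rw [h4, ← h5]
    exact setIntegral_le_integral hFTi (Eventually.of_forall fun x => maxSum_nonneg w _ _)

/-- The maximal inequality. -/
theorem mul_measureReal_birkhoffSum_le [IsProbabilityMeasure μ] (hT : MeasurePreserving T μ μ)
    {u : X → ℝ} (hum : Measurable u) (hu : Integrable u μ) (hu0 : ∀ x, 0 ≤ u x) {l : ℝ}
    (hl : 0 ≤ l) :
    l * μ.real {x | ∃ n : ℕ, n * l < birkhoffSum T u n x} ≤ ∫ x, u x ∂μ := by
  set w : X → ℝ := fun x => u x - l with hw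
  have hwm : Measurable w := hum.sub_const l
  have hwi : Integrable w μ := hu.sub (integrable_const l)
  have hmono : Monotone fun N => {x | 0 < maxSum T w N x} :=
    monotone_nat_of_le_succ fun N x hx => lt_of_lt_of_le hx (maxSum_le_succ w N x)
  have hN : ∀ N, l * μ.real {x | 0 < maxSum T w N x} ≤ ∫ x, u x ∂μ := by
    intro N
    have h1 := setIntegral_maxSum_nonneg hT hwm hwi N
    have h2 : ∫ x in {x | 0 < maxSum T w N x}, w x ∂μ =
        ∫ x in {x | 0 < maxSum T w N x}, u x ∂μ - l * μ.real {x | 0 < maxSum T w N x} := by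
      rw [hw, integral_sub hu.integrableOn (integrable_const l)]
      simp [mul_comm]
    have h3 : ∫ x in {x | 0 < maxSum T w N x}, u x ∂μ ≤ ∫ x, u x ∂μ :=
      setIntegral_le_integral hu (Eventually.of_forall hu0)
    linarith
  have hlim : Tendsto (fun N => l * μ.real {x | 0 < maxSum T w N x}) atTop
      (𝓝 (l * μ.real (⋃ N, {x | 0 < maxSum T w N x}))) := by
    refine Tendsto.const_mul l ?_
    exact (ENNReal.tendsto_toReal (measure_ne_top _ _)).comp (tendsto_measure_iUnion_atTop hmono)
  refine le_trans ?_ (le_of_tendsto' hlim hN)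
  refine mul_le_mul_of_nonneg_left (measureReal_mono ?_) hl
  rintro x ⟨n, hn⟩
  refine mem_iUnion.2 ⟨n, ?_⟩
  refine lt_of_lt_of_le ?_ (birkhoffSum_le_maxSum w n x)
  simp only [birkhoffSum, hw, Finset.sum_sub_distrib, Finset.sum_const, Finset.card_range,
    nsmul_eq_mul] at hn ⊢
  linarith

/-- Birkhoff averages are close in the mean to an invariant function. -/
theorem exists_invariant_integral_abs_sub_le [IsProbabilityMeasure μ]
    (hT : MeasurePreserving T μ μ) {b : X → ℝ} (hb : MemLp b 2 μ) {η : ℝ} (hη : 0 < η) :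
    ∃ (m : ℕ) (g : X → ℝ), 0 < m ∧ Measurable g ∧ Integrable g μ ∧ g ∘ T =ᵐ[μ] g ∧
      ∫ x, |birkhoffAverage ℝ T b m x - g x| ∂μ ≤ η := by
  -- The von Neumann theorem for the Koopman operator. Without ergodicity the limit is only an
  -- invariant function.
  let U : Lp ℝ 2 μ →L[ℝ] Lp ℝ 2 μ :=
    (Lp.compMeasurePreservingₗᵢ ℝ T hT).toContinuousLinearMap
  have hU : ‖U‖ ≤ 1 := LinearIsometry.norm_toContinuousLinearMap_le _
  have hUk : ∀ k : ℕ, (U^[k]) (hb.toLp b) =ᵐ[μ] b ∘ T^[k] := by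
    have : ∀ k : ℕ, (U^[k]) (hb.toLp b) =
        (hb.comp_measurePreserving (hT.iterate k)).toLp (b ∘ T^[k]) := by
      intro k
      induction k with
      | zero => rfl
      | succ k ih =>
        rw [Function.iterate_succ_apply', ih]
        rfl
    intro k
    rw [this k]
    exact MemLp.coeFn_toLp _
  have hlim := U.tendsto_birkhoffAverage_orthogonalProjection hU (hb.toLp b)
  set G := (U.eqLocus (1 : Lp ℝ 2 μ →L[ℝ] Lp ℝ 2 μ)).orthogonalProjectionOnto (hb.toLp b)
  have hUG : U (G : Lp ℝ 2 μ) = G := G.2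
  have hUG' : (G : Lp ℝ 2 μ) ∘ T =ᵐ[μ] (G : Lp ℝ 2 μ) := by
    have h1 : U (G : Lp ℝ 2 μ) =ᵐ[μ] (G : Lp ℝ 2 μ) ∘ T := Lp.coeFn_compMeasurePreserving _ hT
    rw [hUG] at h1
    exact h1.symm
  obtain ⟨m, hm1, hm0⟩ := ((Metric.tendsto_nhds.1 hlim η hη).and (eventually_gt_atTop 0)).exists
  have hGm : AEStronglyMeasurable (G : Lp ℝ 2 μ) μ := Lp.aestronglyMeasurable _
  obtain ⟨g, hgm, hgG⟩ : ∃ g : X → ℝ, Measurable g ∧ (G : Lp ℝ 2 μ) =ᵐ[μ] g :=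
    ⟨_, hGm.stronglyMeasurable_mk.measurable, hGm.ae_eq_mk⟩
  refine ⟨m, g, hm0, hgm, ?_, ?_, ?_⟩
  · exact ((Lp.memLp (G : Lp ℝ 2 μ)).integrable one_le_two).congr hgG
  · exact ((hT.quasiMeasurePreserving.ae_eq_comp hgG).symm.trans hUG').trans hgG
  · have hco : (birkhoffAverage ℝ U _root_.id m (hb.toLp b) - G : Lp ℝ 2 μ) =ᵐ[μ]
        fun x => birkhoffAverage ℝ T b m x - g x := by
      have h1 := Lp.coeFn_sub (birkhoffAverage ℝ U _root_.id m (hb.toLp b)) (G : Lp ℝ 2 μ)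
      have h2 := Lp.coeFn_smul (m : ℝ)⁻¹ (birkhoffSum U _root_.id m (hb.toLp b))
      have h3 := Lp.coeFn_fun_finsetSum (Finset.range m) fun k => (U^[k]) (hb.toLp b)
      have h4 : ∀ᵐ x ∂μ, ∀ k, (U^[k]) (hb.toLp b) x = (b ∘ T^[k]) x := ae_all_iff.2 hUk
      filter_upwards [h1, h2, h3, h4, hgG] with x x1 x2 x3 x4 x5
      rw [x1, Pi.sub_apply, x5]
      congr 1
      change ((m : ℝ)⁻¹ • birkhoffSum U _root_.id m (hb.toLp b) : Lp ℝ 2 μ) x = _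
      rw [x2, Pi.smul_apply]
      change (m : ℝ)⁻¹ • (∑ k ∈ Finset.range m, (U^[k]) (hb.toLp b) : Lp ℝ 2 μ) x = _
      rw [x3]
      simp only [x4]
      rfl
    have hmem : MemLp (fun x => birkhoffAverage ℝ T b m x - g x) 2 μ :=
      (memLp_congr_ae hco).1 (Lp.memLp _)
    have h5 : eLpNorm (fun x => birkhoffAverage ℝ T b m x - g x) 1 μ ≤ ENNReal.ofReal η := by
      calc _ ≤ eLpNorm (fun x => birkhoffAverage ℝ T b m x - g x) 2 μ :=
            eLpNorm_le_eLpNorm_of_exponent_le one_le_two hmem.1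
        _ = eLpNorm (birkhoffAverage ℝ U _root_.id m (hb.toLp b) - G : Lp ℝ 2 μ) 2 μ :=
            (eLpNorm_congr_ae hco).symm
        _ = ENNReal.ofReal ‖(birkhoffAverage ℝ U _root_.id m (hb.toLp b) - G : Lp ℝ 2 μ)‖ := by
            rw [Lp.norm_def, ENNReal.ofReal_toReal (Lp.eLpNorm_ne_top _)]
        _ ≤ ENNReal.ofReal η := by
            refine ENNReal.ofReal_le_ofReal ?_
            rw [← dist_eq_norm]
            exact hm1.le
    have h6 := integral_norm_eq_lintegral_enorm (μ := μ) hmem.1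
    simp only [Real.norm_eq_abs] at h6
    rw [h6, ← eLpNorm_one_eq_lintegral_enorm]
    exact ENNReal.toReal_le_of_le_ofReal hη.le h5

end Ergodic

/-! ### Rare visits along all windows `[M, M + L]` with `L ≥ κ M` -/

section Windows

variable {X : Type*} {T : X → X}

theorem birkhoffSum_le_birkhoffSum_iterate_add {b : X → ℝ} (h0 : ∀ x, 0 ≤ b x) (h1 : ∀ x, b x ≤ 1)
    (K i : ℕ) (y : X) : birkhoffSum T b K y ≤ birkhoffSum T b K (T^[i] y) + i := by
  induction i with
  | zero => simp
  | succ i ih =>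
    have h := birkhoffSum_apply_sub_birkhoffSum T b K (T^[i] y)
    have h2 := h1 (T^[i] y)
    have h3 := h0 (T^[K] (T^[i] y))
    rw [Function.iterate_succ_apply']
    push_cast
    linarith

/-- Moving the start of the window by `i < m` steps loses at most `i` visits; average over these
shifts and exchange the two sums. -/
theorem birkhoffSum_le_birkhoffSum_average_add {b : X → ℝ} (h0 : ∀ x, 0 ≤ b x) (h1 : ∀ x, b x ≤ 1)
    (K : ℕ) {m : ℕ} (hm : 0 < m) (y : X) :
    birkhoffSum T b K y ≤ birkhoffSum T (birkhoffAverage ℝ T b m) K y + m := by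
  have hm' : (0 : ℝ) < m := by exact_mod_cast hm
  have h2 : birkhoffSum T (birkhoffAverage ℝ T b m) K y =
      (m : ℝ)⁻¹ * ∑ i ∈ Finset.range m, birkhoffSum T b K (T^[i] y) := by
    simp only [birkhoffSum, birkhoffAverage, smul_eq_mul, ← Finset.mul_sum]
    rw [Finset.sum_comm]
    simp only [← Function.iterate_add_apply, add_comm]
  have h3 : ∑ i ∈ Finset.range m, (birkhoffSum T b K y - m) ≤
      ∑ i ∈ Finset.range m, birkhoffSum T b K (T^[i] y) := by
    refine Finset.sum_le_sum fun i hi => ?_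
    have h4 := birkhoffSum_le_birkhoffSum_iterate_add (T := T) h0 h1 K i y
    have h5 : (i : ℝ) ≤ m := by exact_mod_cast (Finset.mem_range.1 hi).le
    linarith
  rw [Finset.sum_const, Finset.card_range, nsmul_eq_mul] at h3
  have h6 : birkhoffSum T b K y - m ≤
      (m : ℝ)⁻¹ * ∑ i ∈ Finset.range m, birkhoffSum T b K (T^[i] y) := by
    rw [inv_mul_eq_div, le_div_iff₀ hm']
    linarith
  rw [h2]
  linarith

variable [MeasurableSpace X] {μ : Measure X}

theorem measurable_birkhoffSum (hT : Measurable T) {b : X → ℝ} (hb : Measurable b) (n : ℕ) :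
    Measurable (birkhoffSum T b n) :=
  Finset.measurable_fun_sum _ fun k _ => hb.comp (hT.iterate k)

theorem integral_birkhoffAverage (hT : MeasurePreserving T μ μ) {b : X → ℝ} (hb : Integrable b μ)
    {m : ℕ} (hm : 0 < m) : ∫ x, birkhoffAverage ℝ T b m x ∂μ = ∫ x, b x ∂μ := by
  have hm' : (0 : ℝ) < m := by exact_mod_cast hm
  have h1 : ∀ k : ℕ, ∫ x, b (T^[k] x) ∂μ = ∫ x, b x ∂μ := by
    intro k
    have h2 := integral_map (μ := μ) (hT.iterate k).measurable.aemeasurable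
      (f := b) (by rw [(hT.iterate k).map_eq]; exact hb.aestronglyMeasurable)
    rw [(hT.iterate k).map_eq] at h2
    exact h2.symm
  simp only [birkhoffAverage, birkhoffSum, smul_eq_mul]
  have h3 : ∀ k ∈ Finset.range m, Integrable (fun x => b (T^[k] x)) μ := fun k _ =>
    (hT.iterate k).integrable_comp_of_integrable hb
  rw [integral_const_mul, integral_finsetSum _ h3]
  simp only [h1, Finset.sum_const, Finset.card_range, nsmul_eq_mul]
  field_simp

/-- The orbits of most points visit a small set rarely along every long window. -/
theorem exists_birkhoffSum_indicator_le [IsProbabilityMeasure μ] (hT : MeasurePreserving T μ μ)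
    {B : Set X} (hB : MeasurableSet B) {ε : ℝ} (hε : 0 < ε) (hμB : μ.real B ≤ ε ^ 2 / 32)
    {κ : ℝ} (hκ : 0 < κ) :
    ∃ (Z : Set X) (N₀ : ℕ), MeasurableSet Z ∧ μ.real Zᶜ < ε ∧
      ∀ z ∈ Z, ∀ M L : ℕ, N₀ ≤ L → κ * M ≤ L →
        birkhoffSum T (B.indicator 1) (L + 1) (T^[M] z) ≤ ε * L := by
  set b : X → ℝ := B.indicator 1 with hbdef
  have hb0 : ∀ x, 0 ≤ b x := fun x => indicator_nonneg (fun _ _ => zero_le_one) x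
  have hb1 : ∀ x, b x ≤ 1 := fun x => indicator_le_self' (fun _ _ => zero_le_one) x
  have hbm : Measurable b := measurable_one.indicator hB
  have hbL : MemLp b 2 μ := (memLp_const (1 : ℝ)).indicator hB
  have hbi : Integrable b μ := hbL.integrable one_le_two
  have hbint : ∫ x, b x ∂μ = μ.real B := integral_indicator_one hB
  -- Chosen so that `M ≤ L / κ` gives `(M + L) l ≤ ε L / 8`.
  set l : ℝ := ε / (8 * (1 / κ + 2)) with hl
  have hl0 : 0 < l := by positivity
  obtain ⟨m, g, hm, hgm, hgi, hgT, hgη⟩ := exists_invariant_integral_abs_sub_le hT hbL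
    (η := min (ε ^ 2 / 32) (l * (ε / 4))) (by positivity)
  have hη1 := hgη.trans (min_le_left _ _)
  have hη2 := hgη.trans (min_le_right _ _)
  set u := birkhoffAverage ℝ T b m with hu
  have hum : Measurable u := (measurable_birkhoffSum hT.measurable hbm m).const_smul (m : ℝ)⁻¹
  have hui : Integrable u μ := by
    refine Integrable.smul (m : ℝ)⁻¹ ?_
    exact integrable_finsetSum _ fun k _ => (hT.iterate k).integrable_comp_of_integrable hbi
  have hu0 : ∀ x, 0 ≤ u x := fun x =>
    mul_nonneg (by positivity) (Finset.sum_nonneg fun k _ => hb0 _)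
  set r : X → ℝ := fun x => |u x - g x| with hr
  have hrm : Measurable r := measurable_norm.comp (hum.sub hgm)
  have hri : Integrable r μ := (hui.sub hgi).norm
  have hg1 : ∫ x, |g x| ∂μ ≤ ε ^ 2 / 16 := by
    have h1 : ∫ x, |g x| ∂μ ≤ ∫ x, (u x + r x) ∂μ := by
      refine integral_mono hgi.norm (hui.add hri) fun x => ?_
      have h2 := abs_sub_abs_le_abs_sub (g x) (u x)
      rw [abs_of_nonneg (hu0 x), abs_sub_comm] at h2
      simp only [hr]
      linarith
    rw [integral_add hui hri, hu, integral_birkhoffAverage hT hbi hm, hbint] at h1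
    linarith
  -- The bad points: those with large mean frequency of visits (Markov), those where the averages
  -- stray from the limit (maximal inequality), and the null set where `g` is not invariant along
  -- the orbit.
  set E₁ : Set X := {x | ε / 4 ≤ |g x|} with hE₁
  set E₂ : Set X := {x | ∃ n : ℕ, n * l < birkhoffSum T r n x} with hE₂
  set E₃ : Set X := {x | ∃ n : ℕ, g (T^[n] x) ≠ g x} with hE₃
  have hE₁m : MeasurableSet E₁ := measurableSet_le measurable_const hgm.norm
  have hE₂m : MeasurableSet E₂ := by
    rw [hE₂, ofPred_exists]
    exact MeasurableSet.iUnion fun n =>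
      measurableSet_lt measurable_const (measurable_birkhoffSum hT.measurable hrm n)
  have hE₃m : MeasurableSet E₃ := by
    rw [hE₃, ofPred_exists]
    exact MeasurableSet.iUnion fun n =>
      (measurableSet_eq_fun (hgm.comp (hT.measurable.iterate n)) hgm).compl
  have hμ₁ : μ.real E₁ ≤ ε / 4 := by
    have h1 := mul_meas_ge_le_integral_of_nonneg (Eventually.of_forall fun x => abs_nonneg (g x))
      hgi.norm (ε / 4)
    have h2 : ε / 4 * μ.real E₁ ≤ ε ^ 2 / 16 := h1.trans hg1
    nlinarith
  have hμ₂ : μ.real E₂ ≤ ε / 4 := by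
    have h1 := mul_measureReal_birkhoffSum_le hT hrm hri (fun x => abs_nonneg _) hl0.le
    exact le_of_mul_le_mul_left (h1.trans hη2) hl0
  have hμ₃ : μ.real E₃ = 0 := by
    have h1 : ∀ᵐ x ∂μ, ∀ n : ℕ, g (T^[n] x) = g x := by
      refine ae_all_iff.2 fun n => ?_
      induction n with
      | zero => exact Eventually.of_forall fun x => rfl
      | succ n ih =>
        have h2 := (hT.iterate n).quasiMeasurePreserving.ae_eq_comp hgT
        filter_upwards [h2, ih] with x h3 h4
        rw [Function.iterate_succ_apply', ← h4]
        exact h3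
    have h2 : μ E₃ = 0 := by
      rw [ae_iff] at h1
      simpa [hE₃] using h1
    simp [measureReal_def, h2]
  obtain ⟨N₀, hN₀⟩ := exists_nat_gt ((m + l + ε / 4) * (8 / ε))
  refine ⟨(E₁ ∪ E₂ ∪ E₃)ᶜ, N₀, ((hE₁m.union hE₂m).union hE₃m).compl, ?_, ?_⟩
  · rw [compl_compl]
    have h1 := measureReal_union_le (μ := μ) (E₁ ∪ E₂) E₃
    have h2 := measureReal_union_le (μ := μ) E₁ E₂
    linarith
  · intro z hz M L hL hML
    simp only [mem_compl_iff, mem_union, not_or] at hz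
    obtain ⟨⟨hz1, hz2⟩, hz3⟩ := hz
    simp only [hE₁, mem_ofPred_eq, not_le] at hz1
    simp only [hE₂, mem_ofPred_eq, not_exists, not_lt] at hz2
    simp only [hE₃, mem_ofPred_eq, not_exists, not_not] at hz3
    have h1 := birkhoffSum_le_birkhoffSum_average_add (T := T) hb0 hb1 (L + 1) hm (T^[M] z)
    have h2 : birkhoffSum T u (L + 1) (T^[M] z) ≤
        (L + 1) * |g z| + birkhoffSum T r (L + 1) (T^[M] z) := by
      have h3 : birkhoffSum T u (L + 1) (T^[M] z) ≤
          ∑ k ∈ Finset.range (L + 1), (|g z| + r (T^[k] (T^[M] z))) := by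
        refine Finset.sum_le_sum fun k _ => ?_
        have h4 : g (T^[k] (T^[M] z)) = g z := by rw [← Function.iterate_add_apply, hz3]
        have h5 := le_abs_self (u (T^[k] (T^[M] z)) - g z)
        have h6 := le_abs_self (g z)
        simp only [hr, h4]
        linarith
      rw [Finset.sum_add_distrib] at h3
      simpa [birkhoffSum] using h3
    -- The maximal inequality only controls sums from time `0`, so the window is enlarged to `[0, M
    -- + L]`. This is affordable because `M` is at most a multiple of `L`.
    have h7 : birkhoffSum T r (L + 1) (T^[M] z) ≤ (M + (L + 1 : ℕ) : ℕ) * l := by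
      refine le_trans ?_ (hz2 _)
      rw [birkhoffSum_add T r M (L + 1)]
      have : 0 ≤ birkhoffSum T r M z := Finset.sum_nonneg fun k _ => abs_nonneg _
      linarith
    push_cast at h7
    have hLN : (N₀ : ℝ) ≤ L := by exact_mod_cast hL
    have h8 : (m + l + ε / 4) ≤ L * (ε / 8) := by
      have h9 : (m + l + ε / 4) * (8 / ε) ≤ L := by linarith
      calc (m + l + ε / 4) = (m + l + ε / 4) * (8 / ε) * (ε / 8) := by field_simp
        _ ≤ L * (ε / 8) := by gcongr
    have h10 : (M : ℝ) ≤ L * (1 / κ) := by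
      rw [mul_one_div, le_div_iff₀ hκ]
      linarith
    have h11 : (M + L) * l ≤ L * (ε / 8) := by
      have h12 : l * (1 / κ + 2) = ε / 8 := by
        rw [hl]
        field_simp
      have h13 : (M + L) * l ≤ (L * (1 / κ) + 2 * L) * l := by
        have : (0 : ℝ) ≤ L := Nat.cast_nonneg L
        gcongr
        linarith
      calc _ ≤ _ := h13
        _ = L * (l * (1 / κ + 2)) := by ring
        _ = _ := by rw [h12]
    have h14 : (L + 1) * |g z| ≤ (L + 1) * (ε / 4) := by gcongr
    have h15 : 0 ≤ (L : ℝ) * ε := by positivity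
    nlinarith

end Windows

/-! ### Special flows: group law and invariant measure -/

section FlowLaw

variable {X : Type*} {T : Equiv.Perm X} {f : X → ℝ} {c : ℝ}

@[simp]
theorem cocycle_zero (x : X) : cocycle T f 0 x = 0 := by
  have h : (0 : ℤ) = Int.ofNat 0 := rfl
  rw [h]
  simp [cocycle]

theorem cocycle_natCast (n : ℕ) (x : X) :
    cocycle T f n x = ∑ i ∈ Finset.range n, f ((T ^ i) x) := rfl

theorem cocycle_add (m n : ℤ) (x : X) :
    cocycle T f (m + n) x = cocycle T f m x + cocycle T f n ((T ^ m) x) := by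
  induction n using Int.induction_on with
  | zero => simp
  | succ n ih =>
    rw [← add_assoc, cocycle_succ, ih, cocycle_succ, add_assoc, ← Equiv.Perm.mul_apply, ← zpow_add,
      add_comm m]
  | pred n ih =>
    have h1 := cocycle_succ T f (m + (-(n : ℤ) - 1)) x
    have h2 := cocycle_succ T f (-(n : ℤ) - 1) ((T ^ m) x)
    rw [sub_add_cancel] at h2
    rw [add_assoc, sub_add_cancel, ih] at h1
    rw [← Equiv.Perm.mul_apply, ← zpow_add, add_comm _ m] at h2
    linarith

theorem cocycle_neg (n : ℤ) (x : X) : cocycle T f (-n) ((T ^ n) x) = -cocycle T f n x := by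
  have h := cocycle_add (T := T) (f := f) n (-n) x
  rw [add_neg_cancel, cocycle_zero] at h
  linarith

theorem le_cocycle_natCast (hf : ∀ x, c ≤ f x) (n : ℕ) (x : X) : c * n ≤ cocycle T f n x := by
  rw [cocycle_natCast]
  have h := Finset.card_nsmul_le_sum (Finset.range n) (fun i => f ((T ^ i) x)) c fun i _ => hf _
  simpa [mul_comm] using h

theorem mul_sub_le_cocycle_sub (hf : ∀ x, c ≤ f x) {m n : ℤ} (h : m ≤ n) (x : X) :
    c * (n - m) ≤ cocycle T f n x - cocycle T f m x := by
  obtain ⟨k, rfl⟩ := Int.le.dest h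
  rw [cocycle_add]
  have := le_cocycle_natCast (T := T) hf k ((T ^ m) x)
  push_cast
  linarith

theorem cocycle_mono (hc : 0 < c) (hf : ∀ x, c ≤ f x) {m n : ℤ} (h : m ≤ n) (x : X) :
    cocycle T f m x ≤ cocycle T f n x := by
  have h1 := mul_sub_le_cocycle_sub (T := T) hf h x
  have h2 : (0 : ℝ) ≤ n - m := by exact_mod_cast sub_nonneg.2 h
  nlinarith

theorem eq_of_cocycle_le_lt (hc : 0 < c) (hf : ∀ x, c ≤ f x) {m n : ℤ} {x : X} {r : ℝ}
    (hm : cocycle T f m x ≤ r ∧ r < cocycle T f (m + 1) x)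
    (hn : cocycle T f n x ≤ r ∧ r < cocycle T f (n + 1) x) : m = n := by
  rcases lt_trichotomy m n with h | h | h
  · have := cocycle_mono (T := T) hc hf (show m + 1 ≤ n by omega) x
    linarith
  · exact h
  · have := cocycle_mono (T := T) hc hf (show n + 1 ≤ m by omega) x
    linarith

theorem exists_cocycle_le_lt (hc : 0 < c) (hf : ∀ x, c ≤ f x) (x : X) (r : ℝ) :
    ∃ n : ℤ, cocycle T f n x ≤ r ∧ r < cocycle T f (n + 1) x := by
  have hbdd : ∃ b : ℤ, ∀ z : ℤ, cocycle T f z x ≤ r → z ≤ b := by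
    obtain ⟨b, hb⟩ := exists_nat_gt (r / c)
    refine ⟨b, fun z hz => ?_⟩
    by_contra! hlt
    have h1 := mul_sub_le_cocycle_sub (T := T) hf (show (0 : ℤ) ≤ z by omega) x
    have h2 : ((b : ℤ) : ℝ) < z := by exact_mod_cast hlt
    rw [div_lt_iff₀ hc] at hb
    rw [cocycle_zero] at h1
    push_cast at h1 h2
    nlinarith
  have hne : ∃ z : ℤ, cocycle T f z x ≤ r := by
    obtain ⟨b, hb⟩ := exists_nat_gt (-r / c)
    refine ⟨-(b : ℤ), ?_⟩
    have h1 := mul_sub_le_cocycle_sub (T := T) hf (show -(b : ℤ) ≤ 0 by omega) x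
    rw [div_lt_iff₀ hc] at hb
    rw [cocycle_zero] at h1
    push_cast at h1
    linarith
  obtain ⟨n, hn, hmax⟩ := Int.exists_greatest_of_bdd hbdd hne
  refine ⟨n, hn, ?_⟩
  by_contra! h
  have := hmax _ h
  omega

theorem specialFlow_eq (hc : 0 < c) (hf : ∀ x, c ≤ f x) {t : ℝ} {q : Space f} {n : ℤ}
    (hn : cocycle T f n q.1.1 ≤ q.1.2 + t ∧ q.1.2 + t < cocycle T f (n + 1) q.1.1) :
    (specialFlow T f t q).1 = ((T ^ n) q.1.1, q.1.2 + t - cocycle T f n q.1.1) := by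
  have h : ∃ n : ℤ, cocycle T f n q.1.1 ≤ q.1.2 + t ∧ q.1.2 + t < cocycle T f (n + 1) q.1.1 :=
    ⟨n, hn⟩
  have h1 : (specialFlow T f t q).1 =
      ((T ^ h.choose) q.1.1, q.1.2 + t - cocycle T f h.choose q.1.1) := by
    unfold specialFlow
    exact congrArg Subtype.val (dif_pos h)
  rw [h1, eq_of_cocycle_le_lt hc hf h.choose_spec hn]

theorem specialFlow_spec (hc : 0 < c) (hf : ∀ x, c ≤ f x) (t : ℝ) (q : Space f) :
    ∃ n : ℤ, (cocycle T f n q.1.1 ≤ q.1.2 + t ∧ q.1.2 + t < cocycle T f (n + 1) q.1.1) ∧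
      (specialFlow T f t q).1 = ((T ^ n) q.1.1, q.1.2 + t - cocycle T f n q.1.1) := by
  obtain ⟨n, hn⟩ := exists_cocycle_le_lt (T := T) hc hf q.1.1 (q.1.2 + t)
  exact ⟨n, hn, specialFlow_eq hc hf hn⟩

theorem specialFlow_add (hc : 0 < c) (hf : ∀ x, c ≤ f x) (s t : ℝ) (q : Space f) :
    specialFlow T f (t + s) q = specialFlow T f s (specialFlow T f t q) := by
  obtain ⟨m, hm, hm'⟩ := specialFlow_spec (T := T) hc hf t q
  obtain ⟨n, hn, hn'⟩ := specialFlow_spec (T := T) hc hf s (specialFlow T f t q)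
  simp only [hm'] at hn hn'
  have h1 := cocycle_add (T := T) (f := f) m n q.1.1
  have h2 := cocycle_add (T := T) (f := f) m (n + 1) q.1.1
  rw [← add_assoc] at h2
  have h3 := specialFlow_eq (T := T) (t := t + s) (q := q) (n := m + n) hc hf
    ⟨by linarith, by linarith⟩
  apply Subtype.ext
  rw [h3, hn', ← Equiv.Perm.mul_apply, ← zpow_add, add_comm n m, h1]
  ext
  · rfl
  · change q.1.2 + (t + s) - _ = q.1.2 + t - _ + s - _
    ring

/-- Consequently points on different orbits have different base points, which is how the orbit
condition of `RatnerProperty` is used. -/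
theorem specialFlow_sub_of_base_eq (hc : 0 < c) (hf : ∀ x, c ≤ f x) {q q' : Space f}
    (h : q.1.1 = q'.1.1) : specialFlow T f (q'.1.2 - q.1.2) q = q' := by
  have h1 := q'.2
  have h3 := cocycle_succ T f 0 q.1.1
  rw [cocycle_zero, zpow_zero, Equiv.Perm.one_apply, zero_add] at h3
  have h2 := specialFlow_eq (T := T) (t := q'.1.2 - q.1.2) (q := q) (n := 0) hc hf
    ⟨by rw [cocycle_zero]; linarith [h1.1], by rw [zero_add, h3, h]; linarith [h1.2]⟩
  apply Subtype.ext
  rw [h2]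
  ext
  · simp [h]
  · simp

theorem specialFlow_natCast_mul (hc : 0 < c) (hf : ∀ x, c ≤ f x) (t : ℝ) (n : ℕ) (q : Space f) :
    specialFlow T f (n * t) q = (specialFlow T f t)^[n] q := by
  induction n with
  | zero =>
    have := specialFlow_sub_of_base_eq (T := T) hc hf (q := q) (q' := q) rfl
    simpa using this
  | succ n ih =>
    rw [Function.iterate_succ_apply', ← ih, ← specialFlow_add hc hf]
    congr 1
    push_cast
    ring

end FlowLaw

/-! ### The special flow preserves the restricted product measure -/

section FlowMeasure

variable {X : Type*} {T : Equiv.Perm X} {f : X → ℝ} {c : ℝ}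

/-- The map which the flow at time `t` applies to the points that return `n` times. -/
def skewMap (T : Equiv.Perm X) (f : X → ℝ) (t : ℝ) (n : ℤ) (y : X × ℝ) : X × ℝ :=
  ((T ^ n) y.1, y.2 + t - cocycle T f n y.1)

/-- The points of `X × ℝ` which return `n` times up to time `t`. -/
def returnSet (T : Equiv.Perm X) (f : X → ℝ) (t : ℝ) (n : ℤ) : Set (X × ℝ) :=
  {y | cocycle T f n y.1 ≤ y.2 + t ∧ y.2 + t < cocycle T f (n + 1) y.1}

theorem pairwise_disjoint_returnSet (hc : 0 < c) (hf : ∀ x, c ≤ f x) (t : ℝ) :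
    Pairwise (Function.onFun Disjoint (returnSet T f t)) := by
  intro m n hmn
  refine disjoint_left.2 fun y hm hn => hmn ?_
  exact eq_of_cocycle_le_lt hc hf hm hn

theorem iUnion_returnSet (hc : 0 < c) (hf : ∀ x, c ≤ f x) (t : ℝ) :
    ⋃ n, returnSet T f t n = univ :=
  eq_univ_of_forall fun y => mem_iUnion.2 (exists_cocycle_le_lt hc hf y.1 (y.2 + t))

/-- A point that returns `n` times up to time `t` lands at one that returns `-n` times up to time
`-t`. So the flow carries one countable partition of `X^f` to another, piece by piece. -/
theorem skewMap_preimage (t : ℝ) (n : ℤ) :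
    skewMap T f t n ⁻¹' (returnSet T f (-t) (-n) ∩ {y : X × ℝ | 0 ≤ y.2 ∧ y.2 < f y.1}) =
      returnSet T f t n ∩ {y : X × ℝ | 0 ≤ y.2 ∧ y.2 < f y.1} := by
  ext y
  have h1 := cocycle_succ T f n y.1
  have h2 := cocycle_neg (T := T) (f := f) n y.1
  have h3 := cocycle_succ T f (-n) ((T ^ n) y.1)
  rw [h2, ← Equiv.Perm.mul_apply, ← zpow_add, neg_add_cancel, zpow_zero, Equiv.Perm.one_apply] at h3
  simp only [skewMap, returnSet, mem_preimage, mem_inter_iff, mem_ofPred_eq, h1, h2, h3]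
  constructor
  · rintro ⟨⟨_, _⟩, _, _⟩
    refine ⟨⟨?_, ?_⟩, ?_, ?_⟩ <;> linarith
  · rintro ⟨⟨_, _⟩, _, _⟩
    refine ⟨⟨?_, ?_⟩, ?_, ?_⟩ <;> linarith

theorem specialFlow_preimage (hc : 0 < c) (hf : ∀ x, c ≤ f x) (t : ℝ) (S : Set (X × ℝ)) :
    specialFlow T f t ⁻¹' ((fun q : Space f => q.1) ⁻¹' S) =
      (fun q : Space f => q.1) ⁻¹' ⋃ n, returnSet T f t n ∩ skewMap T f t n ⁻¹' S := by
  ext q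
  obtain ⟨n, hn, hn'⟩ := specialFlow_spec (T := T) hc hf t q
  simp only [mem_preimage, mem_iUnion, mem_inter_iff]
  constructor
  · intro h
    rw [hn'] at h
    exact ⟨n, hn, h⟩
  · rintro ⟨m, hm, h⟩
    rw [specialFlow_eq hc hf hm]
    exact h

variable [MeasureSpace X]

theorem measurable_cocycle (hT : ∀ n : ℤ, Measurable (T ^ n : Equiv.Perm X)) (hf : Measurable f)
    (n : ℤ) : Measurable (cocycle T f n) := by
  rcases n with n | n
  · exact Finset.measurable_fun_sum _ fun i _ => hf.comp (by simpa using hT i)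
  · exact (Finset.measurable_fun_sum _ fun i _ => hf.comp (hT _)).neg

theorem measurableSet_range_val (hf : Measurable f) :
    MeasurableSet {y : X × ℝ | 0 ≤ y.2 ∧ y.2 < f y.1} :=
  (measurableSet_le measurable_const measurable_snd).inter
    (measurableSet_lt measurable_snd (hf.comp measurable_fst))

theorem measurable_val : Measurable fun q : Space f => q.1 := comap_measurable _

theorem measurableEmbedding_val (hf : Measurable f) :
    MeasurableEmbedding fun q : Space f => q.1 := by
  refine ⟨Subtype.val_injective, measurable_val, ?_⟩
  rintro _ ⟨S, hS, rfl⟩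
  have : (fun q : Space f => q.1) '' ((fun q : Space f => q.1) ⁻¹' S) =
      S ∩ {y : X × ℝ | 0 ≤ y.2 ∧ y.2 < f y.1} := by
    rw [image_preimage_eq_inter_range]
    congr 1
    exact Subtype.range_val
  rw [this]
  exact hS.inter (measurableSet_range_val hf)

theorem restrictedMeasure_preimage (hf : Measurable f) (S : Set (X × ℝ)) :
    restrictedMeasure f ((fun q : Space f => q.1) ⁻¹' S) =
      volume (S ∩ {y : X × ℝ | 0 ≤ y.2 ∧ y.2 < f y.1}) := by
  rw [restrictedMeasure, (measurableEmbedding_val hf).comap_apply, image_preimage_eq_inter_range]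
  congr 2
  exact Subtype.range_val

theorem measurableSet_returnSet (hT : ∀ n : ℤ, Measurable (T ^ n : Equiv.Perm X))
    (hf : Measurable f) (t : ℝ) (n : ℤ) : MeasurableSet (returnSet T f t n) :=
  (measurableSet_le ((measurable_cocycle hT hf n).comp measurable_fst)
    (measurable_snd.add_const t)).inter
    (measurableSet_lt (measurable_snd.add_const t)
      ((measurable_cocycle hT hf (n + 1)).comp measurable_fst))

theorem measurePreserving_skewMap [SFinite (volume : Measure X)]
    (hT : ∀ n : ℤ, MeasurePreserving (T ^ n : Equiv.Perm X)) (hf : Measurable f) (t : ℝ) (n : ℤ) :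
    MeasurePreserving (skewMap T f t n) := by
  have hm := measurable_cocycle (fun n => (hT n).measurable) hf n
  refine (hT n).skew_product (g := fun x s => s + t - cocycle T f n x) ?_ ?_
  · exact (measurable_snd.add_const t).sub (hm.comp measurable_fst)
  · refine Eventually.of_forall fun x => ?_
    have : (fun s : ℝ => s + t - cocycle T f n x) = fun s => s + (t - cocycle T f n x) := by
      ext s
      ring
    rw [this]
    exact (measurePreserving_add_right volume _).map_eq

/-- On each piece the flow is a skew product with translations in the fibres, which preserves `μ ×
Lebesgue`; the image pieces again partition `X^f`. -/
theorem measurePreserving_specialFlow [SFinite (volume : Measure X)]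
    (hT : ∀ n : ℤ, MeasurePreserving (T ^ n : Equiv.Perm X)) (hfm : Measurable f)
    (hc : 0 < c) (hf : ∀ x, c ≤ f x) (t : ℝ) :
    MeasurePreserving (specialFlow T f t) (restrictedMeasure f) (restrictedMeasure f) := by
  have hTm : ∀ n : ℤ, Measurable (T ^ n : Equiv.Perm X) := fun n => (hT n).measurable
  have hR := measurableSet_returnSet hTm hfm
  have hY := measurableSet_range_val hfm
  have hmeas : Measurable (specialFlow T f t) := by
    rintro _ ⟨S, hS, rfl⟩
    rw [specialFlow_preimage hc hf]
    exact measurable_val (MeasurableSet.iUnion fun n =>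
      (hR t n).inter ((measurePreserving_skewMap hT hfm t n).measurable hS))
  refine ⟨hmeas, Measure.ext ?_⟩
  rintro _ ⟨S, hS, rfl⟩
  rw [Measure.map_apply hmeas (measurable_val hS), specialFlow_preimage hc hf,
    restrictedMeasure_preimage hfm, restrictedMeasure_preimage hfm, iUnion_inter]
  have h1 : ∀ n, returnSet T f t n ∩ skewMap T f t n ⁻¹' S ∩ {y : X × ℝ | 0 ≤ y.2 ∧ y.2 < f y.1} =
      skewMap T f t n ⁻¹'
        (returnSet T f (-t) (-n) ∩ (S ∩ {y : X × ℝ | 0 ≤ y.2 ∧ y.2 < f y.1})) := by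
    intro n
    rw [inter_right_comm, ← skewMap_preimage, ← preimage_inter, inter_assoc, inter_comm S]
  have hSY := hS.inter hY
  rw [measure_iUnion ?_ fun n => ?_]
  · have h2 : ∀ n, volume (returnSet T f t n ∩ skewMap T f t n ⁻¹' S ∩
        {y : X × ℝ | 0 ≤ y.2 ∧ y.2 < f y.1}) =
        volume (returnSet T f (-t) (-n) ∩ (S ∩ {y : X × ℝ | 0 ≤ y.2 ∧ y.2 < f y.1})) := by
      intro n
      rw [h1]
      exact (measurePreserving_skewMap hT hfm t n).measure_preimage
        ((hR (-t) (-n)).inter hSY).nullMeasurableSet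
    simp only [h2]
    have h3 := (Equiv.neg ℤ).tsum_eq fun n => volume (returnSet T f (-t) n ∩
      (S ∩ {y : X × ℝ | 0 ≤ y.2 ∧ y.2 < f y.1}))
    simp only [Equiv.neg_apply] at h3
    rw [h3, ← measure_iUnion ?_ fun n => ?_,
      ← iUnion_inter, iUnion_returnSet hc hf, univ_inter]
    · intro m n hmn
      exact ((pairwise_disjoint_returnSet hc hf (-t)) hmn).mono inter_subset_left inter_subset_left
    · exact (hR (-t) n).inter hSY
  · intro m n hmn
    exact ((pairwise_disjoint_returnSet hc hf t) hmn).mono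
      (inter_subset_left.trans inter_subset_left) (inter_subset_left.trans inter_subset_left)
  · exact ((hR t n).inter ((measurePreserving_skewMap hT hfm t n).measurable hS)).inter hY

theorem restrictedMeasure_univ_eq (hfm : Measurable f) [SFinite (volume : Measure X)] :
    restrictedMeasure f univ = ∫⁻ x, ENNReal.ofReal (f x) := by
  have h := restrictedMeasure_preimage hfm univ
  rw [preimage_univ] at h
  rw [h, univ_inter]
  have h2 : ({y : X × ℝ | 0 ≤ y.2 ∧ y.2 < f y.1}) =
      {y : X × ℝ | y.2 ∈ Ico (0 : ℝ) (f y.1)} := rfl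
  have hY := measurableSet_range_val hfm
  rw [Measure.volume_eq_prod, Measure.prod_apply hY]
  refine lintegral_congr fun x => ?_
  change volume (Ico 0 (f x)) = _
  simp

end FlowMeasure

/-! ### Visits of a rotation to short arcs -/

section ArcCount

/-- The number of `l < k` with `t ∈ [a + l α, a + l α + τ)` modulo `1`. -/
def arcCount (α a τ : ℝ) (k : ℕ) (t : ℝ) : ℤ :=
  ∑ l ∈ Finset.range k, (⌈a + l * α + τ - t⌉ - ⌈a + l * α - t⌉)

variable {α a τ : ℝ}

theorem ceil_sub_ceil_nonneg (hτ : 0 ≤ τ) (x t : ℝ) : 0 ≤ ⌈x + τ - t⌉ - ⌈x - t⌉ :=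
  sub_nonneg.2 (Int.ceil_le_ceil (by linarith))

theorem arcCount_nonneg (hτ : 0 ≤ τ) (k : ℕ) (t : ℝ) : 0 ≤ arcCount α a τ k t :=
  Finset.sum_nonneg fun _ _ => ceil_sub_ceil_nonneg hτ _ _

theorem arcCount_mono (hτ : 0 ≤ τ) (t : ℝ) : Monotone fun k => arcCount α a τ k t :=
  monotone_nat_of_le_succ fun k => by
    simp only [arcCount, Finset.sum_range_succ]
    exact le_add_of_nonneg_right (ceil_sub_ceil_nonneg hτ _ _)

/-- If `t` is visited at times `l ≠ l'` below `k`, its offsets in the two arcs differ by at least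
the distance of `(l' - l) α` to the integers, hence by `1 / (A k)`. All offsets lie in `[0, τ)` with
`τ ≤ 1 / k`, so there are at most `⌈A⌉` of them. -/
theorem arcCount_lt {A : ℝ} (hA : 0 < A)
    (hα : ∀ m : ℕ, 0 < m → ∀ k : ℤ, 1 ≤ A * m * |m * α - k|)
    (hτ1 : τ ≤ 1) {k : ℕ} (hk : k * τ ≤ 1) (t : ℝ) :
    (arcCount α a τ k t : ℝ) < A + 1 := by
  set e : ℕ → ℤ := fun l => ⌈a + l * α + τ - t⌉ - ⌈a + l * α - t⌉ with he
  have he1 : ∀ l, e l ≤ 1 := by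
    intro l
    have h1 : ⌈a + l * α + τ - t⌉ ≤ ⌈a + l * α - t⌉ + 1 := by
      rw [← Int.ceil_add_one]
      exact Int.ceil_le_ceil (by linarith)
    simp only [he]
    omega
  set s := (Finset.range k).filter fun l => 0 < e l with hs
  have hcount : arcCount α a τ k t ≤ s.card := by
    rw [hs, Finset.card_filter, arcCount]
    push_cast
    refine Finset.sum_le_sum fun l _ => ?_
    have := he1 l
    split_ifs with h
    · exact this
    · exact not_lt.1 h
  set u : ℕ → ℝ := fun l => ⌈a + l * α - t⌉ - (a + l * α - t) with hu
  have hu0 : ∀ l, 0 ≤ u l := fun l => sub_nonneg.2 (Int.le_ceil _)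
  have huτ : ∀ l ∈ s, u l < τ := by
    intro l hl
    have h1 : ⌈a + l * α - t⌉ < ⌈a + l * α + τ - t⌉ := by
      have := (Finset.mem_filter.1 hl).2
      simp only [he] at this
      omega
    have h2 := Int.lt_ceil.1 h1
    simp only [hu]
    linarith
  -- Offsets are sorted into bins of width `1 / (A k)`; two visits never share a bin.
  have hcard : s.card ≤ (Finset.Ico 0 ⌈A⌉).card := by
    refine Finset.card_le_card_of_injOn (fun l => ⌊u l * (A * k)⌋) ?_ ?_
    · intro l hl
      simp only [Finset.coe_Ico, mem_Ico]
      refine ⟨Int.floor_nonneg.2 (mul_nonneg (hu0 l) (by positivity)), ?_⟩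
      rw [Int.floor_lt]
      refine lt_of_lt_of_le ?_ (Int.le_ceil A)
      have hk0 : 0 < k := lt_of_le_of_lt (Nat.zero_le l)
        (Finset.mem_range.1 (Finset.mem_filter.1 hl).1)
      have hk0' : (0 : ℝ) < k := by exact_mod_cast hk0
      calc u l * (A * k) < τ * (A * k) := by
            have := huτ l hl
            gcongr
        _ = A * (k * τ) := by ring
        _ ≤ A := by nlinarith
    · have key : ∀ l ∈ s, ∀ l' ∈ s, l < l' → ⌊u l * (A * k)⌋ ≠ ⌊u l' * (A * k)⌋ := by
        intro l hl l' hl' hlt heq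
        have h1 := Int.abs_sub_lt_one_of_floor_eq_floor heq
        have h2 := hα (l' - l) (by omega) (⌈a + l' * α - t⌉ - ⌈a + l * α - t⌉)
        have h3 : |((l' - l : ℕ) : ℝ) * α - ((⌈a + l' * α - t⌉ - ⌈a + l * α - t⌉ : ℤ) : ℝ)| =
            |u l - u l'| := by
          rw [Nat.cast_sub hlt.le]
          push_cast
          simp only [hu]
          congr 1
          ring
        rw [h3] at h2
        have hlk : ((l' - l : ℕ) : ℝ) ≤ k := by
          have := Finset.mem_range.1 (Finset.mem_filter.1 hl').1
          exact_mod_cast (by omega : l' - l ≤ k)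
        rw [← sub_mul, abs_mul, abs_of_nonneg (a := A * (k : ℝ)) (by positivity)] at h1
        have h4 : A * ((l' - l : ℕ) : ℝ) * |u l - u l'| ≤ A * k * |u l - u l'| := by gcongr
        linarith
      intro l hl l' hl' heq
      rcases lt_trichotomy l l' with h | h | h
      · exact absurd heq (key l hl l' hl' h)
      · exact h
      · exact absurd heq.symm (key l' hl' l hl h)
  rw [Int.card_Ico, sub_zero] at hcard
  have h1 : (arcCount α a τ k t : ℝ) ≤ ⌈A⌉ := by
    have h2 : ((⌈A⌉.toNat : ℕ) : ℤ) = ⌈A⌉ := Int.toNat_of_nonneg (Int.ceil_nonneg hA.le)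
    have h3 : (s.card : ℤ) ≤ ⌈A⌉ := by
      rw [← h2]
      exact_mod_cast hcard
    exact_mod_cast hcount.trans h3
  exact lt_of_le_of_lt h1 (Int.ceil_lt_add_one A)

end ArcCount

/-! ### Primitives of periodic functions -/

section CeilPrimitive

variable {E : Type*} [NormedAddCommGroup E] [NormedSpace ℝ E]

/-- The primitive, vanishing at `0`, of the `1`-periodic function which is `ψ` on `[0, 1)`. -/
def ceilPrimitive (ψ : ℝ → E) (b : ℝ) : E := ∫ t in (0 : ℝ)..1, (⌈b - t⌉ : ℝ) • ψ t

variable {ψ : ℝ → E}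

theorem measurable_ceil_sub (b : ℝ) : Measurable fun t : ℝ => (⌈b - t⌉ : ℝ) :=
  (measurable_from_top (f := fun n : ℤ => (n : ℝ))).comp
    (Int.measurable_ceil.comp (measurable_const.sub measurable_id))

theorem intervalIntegrable_bdd_smul {w : ℝ → ℝ} (hw : Measurable w) {B : ℝ}
    (hB : ∀ t ∈ Set.uIoc (0 : ℝ) 1, |w t| ≤ B) (hψ : IntervalIntegrable ψ volume 0 1) :
    IntervalIntegrable (fun t => w t • ψ t) volume 0 1 := by
  rw [intervalIntegrable_iff] at hψ ⊢
  refine Integrable.bdd_smul hψ B hw.aestronglyMeasurable ?_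
  exact (ae_restrict_iff' measurableSet_uIoc).2 (Eventually.of_forall fun t ht => hB t ht)

theorem intervalIntegrable_ceil_smul (hψ : IntervalIntegrable ψ volume 0 1) (b : ℝ) :
    IntervalIntegrable (fun t => (⌈b - t⌉ : ℝ) • ψ t) volume 0 1 := by
  refine intervalIntegrable_bdd_smul (measurable_ceil_sub b) (B := |b| + 2) (fun t ht => ?_) hψ
  rw [uIoc_of_le zero_le_one] at ht
  have h1 := Int.le_ceil (b - t)
  have h2 := Int.ceil_lt_add_one (b - t)
  have h3 := abs_le.1 (le_refl |b|)
  rw [abs_le]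
  constructor <;> linarith [ht.1, ht.2]

theorem ceilPrimitive_add_one (hψ : IntervalIntegrable ψ volume 0 1) (b : ℝ) :
    ceilPrimitive ψ (b + 1) = ceilPrimitive ψ b + ∫ t in (0 : ℝ)..1, ψ t := by
  rw [ceilPrimitive, ceilPrimitive, ← intervalIntegral.integral_add
    (intervalIntegrable_ceil_smul hψ b) hψ]
  congr 1
  ext t
  rw [show b + 1 - t = b - t + 1 by ring, Int.ceil_add_one]
  push_cast
  rw [add_smul, one_smul]

theorem ceilPrimitive_of_mem_Icc (hψ : IntervalIntegrable ψ volume 0 1) {b : ℝ}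
    (hb : b ∈ Icc (0 : ℝ) 1) : ceilPrimitive ψ b = ∫ t in (0 : ℝ)..b, ψ t := by
  have h1 : IntervalIntegrable (fun t => (⌈b - t⌉ : ℝ) • ψ t) volume 0 b :=
    (intervalIntegrable_ceil_smul hψ b).mono_set (by
      rw [uIcc_of_le hb.1, uIcc_of_le zero_le_one]
      exact Icc_subset_Icc_right hb.2)
  have h2 : IntervalIntegrable (fun t => (⌈b - t⌉ : ℝ) • ψ t) volume b 1 :=
    (intervalIntegrable_ceil_smul hψ b).mono_set (by
      rw [uIcc_of_le hb.2, uIcc_of_le zero_le_one]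
      exact Icc_subset_Icc_left hb.1)
  rw [ceilPrimitive, ← intervalIntegral.integral_add_adjacent_intervals h1 h2]
  have h3 : ∫ t in b..1, (⌈b - t⌉ : ℝ) • ψ t = 0 := by
    rw [intervalIntegral.integral_of_le hb.2, integral_Ioc_eq_integral_Ioo]
    refine setIntegral_eq_zero_of_forall_eq_zero fun t ht => ?_
    have : ⌈b - t⌉ = 0 := by
      rw [Int.ceil_eq_iff]
      push_cast
      constructor <;> linarith [ht.1, ht.2, hb.1]
    simp [this]
  have h4 : ∫ t in (0 : ℝ)..b, (⌈b - t⌉ : ℝ) • ψ t = ∫ t in (0 : ℝ)..b, ψ t := by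
    rw [intervalIntegral.integral_of_le hb.1, intervalIntegral.integral_of_le hb.1,
      integral_Ioc_eq_integral_Ioo, integral_Ioc_eq_integral_Ioo]
    refine setIntegral_congr_fun measurableSet_Ioo fun t ht => ?_
    have : ⌈b - t⌉ = 1 := by
      rw [Int.ceil_eq_iff]
      push_cast
      constructor <;> linarith [ht.1, ht.2, hb.2]
    simp [this]
  rw [h3, h4, add_zero]

/-- Both functions have the same increment over a period, so their difference is periodic and it
suffices to compare them on `[0, 1)`. -/
theorem eq_ceilPrimitive (hψ : IntervalIntegrable ψ volume 0 1) {H : ℝ → E}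
    (h1 : ∀ b, H (b + 1) = H b + ∫ t in (0 : ℝ)..1, ψ t)
    (h2 : ∀ b ∈ Ico (0 : ℝ) 1, H b = ∫ t in (0 : ℝ)..b, ψ t) (b : ℝ) :
    H b = ceilPrimitive ψ b := by
  have hper : Function.Periodic (fun b => H b - ceilPrimitive ψ b) 1 := by
    intro b
    simp only [h1, ceilPrimitive_add_one hψ]
    abel
  obtain ⟨y, hy, hby⟩ := hper.exists_mem_Ico₀ one_pos b
  simp only [h2 y hy, ceilPrimitive_of_mem_Icc hψ (Ico_subset_Icc_self hy), sub_self] at hby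
  exact sub_eq_zero.1 hby

variable (α a τ : ℝ)

/-- The kernel `⌈b - t⌉` of `ceilPrimitive` is the one in `arcCount`, so increments of a primitive
summed along an orbit become an integral against the visit count. -/
theorem integral_arcCount_smul (hψ : IntervalIntegrable ψ volume 0 1) (k : ℕ) :
    ∫ t in (0 : ℝ)..1, (arcCount α a τ k t : ℝ) • ψ t =
      ∑ l ∈ Finset.range k,
        (ceilPrimitive ψ (a + l * α + τ) - ceilPrimitive ψ (a + l * α)) := by
  simp only [arcCount, Int.cast_sum, Int.cast_sub, Finset.sum_smul, sub_smul]
  rw [intervalIntegral.integral_finsetSum fun l _ =>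
    (intervalIntegrable_ceil_smul hψ _).sub (intervalIntegrable_ceil_smul hψ _)]
  refine Finset.sum_congr rfl fun l _ => ?_
  exact intervalIntegral.integral_sub (intervalIntegrable_ceil_smul hψ _)
    (intervalIntegrable_ceil_smul hψ _)

end CeilPrimitive

/-! ### Equidistribution of the rotation at the scale of short arcs -/

section ArcError

variable {E : Type*} [NormedAddCommGroup E] [NormedSpace ℝ E]

/-- The difference between the integral against the number of visits and its expected value. -/
def arcError (α a τ : ℝ) (k : ℕ) (ψ : ℝ → E) : E :=
  (∫ t in (0 : ℝ)..1, (arcCount α a τ k t : ℝ) • ψ t) - (k * τ) • ∫ t in (0 : ℝ)..1, ψ t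

variable {α a τ A : ℝ} {ψ ψ' : ℝ → E} {k : ℕ}

theorem intervalIntegrable_arcCount_smul (hψ : IntervalIntegrable ψ volume 0 1) :
    IntervalIntegrable (fun t => (arcCount α a τ k t : ℝ) • ψ t) volume 0 1 := by
  simp only [arcCount, Int.cast_sum, Int.cast_sub, Finset.sum_smul, sub_smul]
  have h := IntervalIntegrable.sum (Finset.range k) (μ := volume) (a := 0) (b := 1)
    (f := fun l t => (⌈a + l * α + τ - t⌉ : ℝ) • ψ t - (⌈a + l * α - t⌉ : ℝ) • ψ t) fun l _ =>
    (intervalIntegrable_ceil_smul hψ _).sub (intervalIntegrable_ceil_smul hψ _)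
  rwa [Finset.sum_fn] at h

theorem arcError_add (hψ : IntervalIntegrable ψ volume 0 1)
    (hψ' : IntervalIntegrable ψ' volume 0 1) :
    arcError α a τ k (fun t => ψ t + ψ' t) = arcError α a τ k ψ + arcError α a τ k ψ' := by
  simp only [arcError, smul_add]
  rw [intervalIntegral.integral_add hψ hψ', intervalIntegral.integral_add
    (intervalIntegrable_arcCount_smul hψ) (intervalIntegrable_arcCount_smul hψ'), smul_add]
  abel

/-- The visit count is below `A + 1` and `k τ ≤ 1`. The bound, uniform in `a`, `τ` and `k`, allows
approximation in L¹. -/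
theorem norm_arcError_le (hA : 0 < A) (hα : ∀ m : ℕ, 0 < m → ∀ k : ℤ, 1 ≤ A * m * |m * α - k|)
    (hτ : 0 ≤ τ) (hτ1 : τ ≤ 1) (hk : k * τ ≤ 1) (hψ : IntervalIntegrable ψ volume 0 1) :
    ‖arcError α a τ k ψ‖ ≤ (A + 2) * ∫ t in (0 : ℝ)..1, ‖ψ t‖ := by
  have h1 : ‖∫ t in (0 : ℝ)..1, (arcCount α a τ k t : ℝ) • ψ t‖ ≤
      (A + 1) * ∫ t in (0 : ℝ)..1, ‖ψ t‖ := by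
    rw [← intervalIntegral.integral_const_mul]
    refine intervalIntegral.norm_integral_le_of_norm_le zero_le_one
      (Eventually.of_forall fun t _ => ?_) (hψ.norm.const_mul _)
    rw [norm_smul, Real.norm_eq_abs, abs_of_nonneg (by exact_mod_cast arcCount_nonneg hτ k t)]
    exact mul_le_mul_of_nonneg_right (arcCount_lt hA hα hτ1 hk t).le (norm_nonneg _)
  have h2 : ‖((k : ℝ) * τ) • ∫ t in (0 : ℝ)..1, ψ t‖ ≤ 1 * ∫ t in (0 : ℝ)..1, ‖ψ t‖ := by
    rw [norm_smul, Real.norm_eq_abs, abs_of_nonneg (by positivity)]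
    gcongr
    exact intervalIntegral.norm_integral_le_integral_norm zero_le_one
  refine (norm_sub_le _ _).trans ?_
  linarith

end ArcError

/-! ### The error for trigonometric polynomials, and passage to integrable functions -/

section Fourier

variable {α a τ A : ℝ} {k : ℕ}

theorem intervalIntegrable_coe (ψ : C(UnitAddCircle, ℂ)) :
    IntervalIntegrable (fun t : ℝ => ψ (t : UnitAddCircle)) volume 0 1 :=
  (ψ.continuous.comp (AddCircle.continuous_mk' 1)).intervalIntegrable _ _

theorem fourier_coe_add (n : ℤ) (x y : ℝ) :
    fourier n ((x + y : ℝ) : UnitAddCircle) =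
      fourier n (x : UnitAddCircle) * fourier n (y : UnitAddCircle) := by
  simp only [fourier_coe_apply, ← Complex.exp_add]
  congr 1
  push_cast
  ring

theorem ceilPrimitive_fourier {n : ℤ} (hn : n ≠ 0) (b : ℝ) :
    ceilPrimitive (fun t : ℝ => fourier n (t : UnitAddCircle)) b =
      (fourier n (b : UnitAddCircle) - 1) / (2 * Real.pi * Complex.I * n) := by
  have hne : (2 * Real.pi * Complex.I * n : ℂ) ≠ 0 := by
    simp [hn, Real.pi_ne_zero]
  have hint : ∀ b : ℝ, ∫ t in (0 : ℝ)..b, fourier n (t : UnitAddCircle) =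
      (fourier n (b : UnitAddCircle) - 1) / (2 * Real.pi * Complex.I * n) := by
    intro b
    simp only [fourier_coe_apply]
    have h1 : ∀ t : ℝ, 2 * Real.pi * Complex.I * n * t / ((1 : ℝ) : ℂ) =
        (2 * Real.pi * Complex.I * n) * t := by
      intro t
      simp
    simp only [h1]
    rw [integral_exp_mul_complex hne]
    simp
  refine (eq_ceilPrimitive (intervalIntegrable_coe (fourier n)) (H := fun b : ℝ =>
    (fourier n (b : UnitAddCircle) - 1) / (2 * Real.pi * Complex.I * n)) (fun b => ?_)
    (fun b _ => ?_) b).symm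
  · rw [hint 1, fourier_coe_add]
    simp [mul_comm _ (n : ℂ), Complex.exp_int_mul_two_pi_mul_I]
  · exact (hint b).symm

/-- For `n ≠ 0` the sum along the orbit is geometric with ratio `z = e(nα) ≠ 1`, hence bounded in
`k`, while the increment of the primitive over the arc is `O(τ)`. For `n = 0` the error vanishes. -/
theorem exists_norm_arcError_fourier_le (hα : Irrational α) (n : ℤ) :
    ∃ K : ℝ, ∀ (a τ : ℝ) (k : ℕ), 0 ≤ τ →
      ‖arcError α a τ k (fun t : ℝ => fourier n (t : UnitAddCircle))‖ ≤ K * τ := by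
  rcases eq_or_ne n 0 with rfl | hn
  · refine ⟨0, fun a τ k _ => ?_⟩
    have h1 : ∀ b : ℝ, ceilPrimitive (fun t : ℝ => fourier 0 (t : UnitAddCircle)) b = (b : ℂ) := by
      intro b
      refine (eq_ceilPrimitive (intervalIntegrable_coe _) (fun b => ?_) (fun b _ => ?_) b).symm
        <;> simp
    rw [arcError, integral_arcCount_smul α a τ (intervalIntegrable_coe _)]
    simp only [h1]
    simp
  · have hne : (2 * Real.pi * Complex.I * n : ℂ) ≠ 0 := by
      simp [hn, Real.pi_ne_zero]
    set z : ℂ := fourier n (α : UnitAddCircle) with hz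
    have hz1 : z ≠ 1 := by
      intro h
      rw [hz, fourier_coe_apply, Complex.exp_eq_one_iff] at h
      obtain ⟨m, hm⟩ := h
      have h2 : (n : ℂ) * α = m := by
        have h3 : (2 * Real.pi * Complex.I : ℂ) ≠ 0 := by simp [Real.pi_ne_zero]
        refine mul_left_cancel₀ h3 ?_
        rw [← mul_comm (m : ℂ), ← hm]
        simp
        ring
      have h4 : (n : ℝ) * α = m := by exact_mod_cast h2
      exact (hα.intCast_mul hn).ne_int m h4
    have hznorm : ‖z‖ = 1 := by rw [hz, fourier_apply]; exact Circle.norm_coe _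
    refine ⟨2 / ‖z - 1‖, fun a τ k hτ => ?_⟩
    have hpow : ∀ l : ℕ, fourier n ((l * α : ℝ) : UnitAddCircle) = z ^ l := by
      intro l
      induction l with
      | zero => simp
      | succ l ih =>
        rw [pow_succ, ← ih, hz, ← fourier_coe_add]
        congr 2
        push_cast
        ring
    have hint : ∫ t in (0 : ℝ)..1, fourier n (t : UnitAddCircle) = 0 := by
      have h1 := ceilPrimitive_of_mem_Icc (intervalIntegrable_coe (fourier n)) (b := 1) (by simp)
      rw [← h1, ceilPrimitive_fourier hn]
      simp [mul_comm _ (n : ℂ), Complex.exp_int_mul_two_pi_mul_I]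
    have hsum : arcError α a τ k (fun t : ℝ => fourier n (t : UnitAddCircle)) =
        fourier n (a : UnitAddCircle) * (fourier n (τ : UnitAddCircle) - 1) /
          (2 * Real.pi * Complex.I * n) * ((z ^ k - 1) / (z - 1)) := by
      rw [arcError, hint, smul_zero, sub_zero, integral_arcCount_smul α a τ
        (intervalIntegrable_coe _), ← geom_sum_eq hz1, Finset.mul_sum]
      refine Finset.sum_congr rfl fun l _ => ?_
      rw [ceilPrimitive_fourier hn, ceilPrimitive_fourier hn]
      simp only [fourier_coe_add, hpow]
      field_simp
      ring
    have h1 : ‖z ^ k - 1‖ ≤ 2 := by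
      refine (norm_sub_le _ _).trans ?_
      simp [hznorm]
      norm_num
    have h2 : ‖(fourier n (τ : UnitAddCircle) : ℂ) - 1‖ ≤ ‖(2 * Real.pi * Complex.I * n : ℂ)‖ * τ := by
      have h3 := Real.norm_exp_I_mul_ofReal_sub_one_le (x := 2 * Real.pi * n * τ)
      rw [fourier_coe_apply]
      have h4 : (2 * Real.pi * Complex.I * n * τ / ((1 : ℝ) : ℂ) : ℂ) =
          Complex.I * ((2 * Real.pi * n * τ : ℝ) : ℂ) := by
        push_cast
        ring
      rw [h4]
      refine h3.trans ?_
      simp [abs_of_nonneg hτ]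
    have h3 : ‖(fourier n (a : UnitAddCircle) : ℂ)‖ = 1 := by
      rw [fourier_apply]; exact Circle.norm_coe _
    have h5 : 0 < ‖(2 * Real.pi * Complex.I * n : ℂ)‖ := norm_pos_iff.2 hne
    have h6 : 0 < ‖z - 1‖ := norm_pos_iff.2 (sub_ne_zero.2 hz1)
    rw [hsum, norm_mul, norm_div, norm_div, norm_mul, h3, one_mul]
    calc _ ≤ (‖(2 * Real.pi * Complex.I * n : ℂ)‖ * τ / ‖(2 * Real.pi * Complex.I * n : ℂ)‖) *
          (2 / ‖z - 1‖) := by gcongr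
      _ = 2 / ‖z - 1‖ * τ := by
        field_simp

theorem exists_norm_arcError_le_of_mem_span (hα : Irrational α) {ψ : C(UnitAddCircle, ℂ)}
    (hψ : ψ ∈ Submodule.span ℂ (Set.range (fourier (T := 1)))) :
    ∃ K : ℝ, ∀ (a τ : ℝ) (k : ℕ), 0 ≤ τ →
      ‖arcError α a τ k (fun t : ℝ => ψ (t : UnitAddCircle))‖ ≤ K * τ := by
  induction hψ using Submodule.span_induction with
  | mem ψ h =>
    obtain ⟨n, rfl⟩ := h
    exact exists_norm_arcError_fourier_le hα n
  | zero => exact ⟨0, fun a τ k _ => by simp [arcError]⟩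
  | add ψ ψ' _ _ h h' =>
    obtain ⟨K, hK⟩ := h
    obtain ⟨K', hK'⟩ := h'
    refine ⟨K + K', fun a τ k hτ => ?_⟩
    have h1 := arcError_add (α := α) (a := a) (τ := τ) (k := k) (intervalIntegrable_coe ψ)
      (intervalIntegrable_coe ψ')
    change ‖arcError α a τ k fun t : ℝ => ψ (t : UnitAddCircle) + ψ' (t : UnitAddCircle)‖ ≤ _
    rw [h1]
    refine (norm_add_le _ _).trans ?_
    have := hK a τ k hτ
    have := hK' a τ k hτ
    linarith
  | smul r ψ _ h =>
    obtain ⟨K, hK⟩ := h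
    refine ⟨‖r‖ * K, fun a τ k hτ => ?_⟩
    have h1 : arcError α a τ k (fun t : ℝ => (r • ψ) (t : UnitAddCircle)) =
        r * arcError α a τ k (fun t : ℝ => ψ (t : UnitAddCircle)) := by
      simp only [arcError, ContinuousMap.coe_smul, Pi.smul_apply, smul_comm _ r]
      simp only [smul_eq_mul, intervalIntegral.integral_const_mul, mul_sub]
      rw [mul_smul_comm]
    rw [h1, norm_mul, mul_assoc]
    exact mul_le_mul_of_nonneg_left (hK a τ k hτ) (norm_nonneg _)

/-- Trigonometric polynomials are dense in the integrable functions on `[0, 1]`. -/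
theorem exists_mem_span_fourier_integral_norm_sub_le {φ : ℝ → ℂ}
    (hφ : IntervalIntegrable φ volume 0 1) {η : ℝ} (hη : 0 < η) :
    ∃ ψ ∈ Submodule.span ℂ (Set.range (fourier (T := 1))),
      ∫ t in (0 : ℝ)..1, ‖φ t - ψ (t : UnitAddCircle)‖ ≤ η := by
  rw [intervalIntegrable_iff_integrableOn_Ioc_of_le zero_le_one] at hφ
  obtain ⟨φ₀, hφ₀, hφφ₀⟩ := hφ.aestronglyMeasurable
  -- The function is moved to the circle, where the density of the characters in L¹ is available.
  let e := AddCircle.measurableEquivIoc (1 : ℝ) 0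
  set g : UnitAddCircle → ℂ := fun z => φ₀ (e z) with hg
  have hgm : StronglyMeasurable g :=
    hφ₀.comp_measurable (measurable_subtype_coe.comp e.measurable)
  have hge : ∀ t ∈ Ioc (0 : ℝ) 1, g (t : UnitAddCircle) = φ₀ t := by
    intro t ht
    have : e (t : UnitAddCircle) = ⟨t, by simpa using ht⟩ :=
      (AddCircle.equivIoc (1 : ℝ) 0).apply_symm_apply ⟨t, by simpa using ht⟩
    simp only [hg, this]
  have hvol : (AddCircle.haarAddCircle : Measure UnitAddCircle) = volume := by
    rw [AddCircle.volume_eq_smul_haarAddCircle]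
    simp
  have hgi : Integrable g (volume : Measure UnitAddCircle) := by
    have h1 := UnitAddCircle.measurePreserving_mk 0
    rw [zero_add] at h1
    refine (h1.integrable_comp hgm.aestronglyMeasurable).1 ?_
    refine (hφ.congr hφφ₀).congr ?_
    exact (ae_restrict_iff' measurableSet_Ioc).2 (Eventually.of_forall fun t ht => (hge t ht).symm)
  have hgL : MemLp g 1 (AddCircle.haarAddCircle : Measure UnitAddCircle) := by
    rw [hvol]
    exact memLp_one_iff_integrable.2 hgi
  have hspan := span_fourierLp_closure_eq_top (T := 1) (p := 1) ENNReal.one_ne_top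
  have hmem : hgL.toLp g ∈ closure
      ((Submodule.span ℂ (Set.range (fourierLp (T := 1) 1)) :
        Submodule ℂ (Lp ℂ 1 (AddCircle.haarAddCircle (T := 1)))) : Set _) := by
    rw [← Submodule.topologicalClosure_coe, hspan]
    trivial
  obtain ⟨s, hs, hsd⟩ := Metric.mem_closure_iff.1 hmem η hη
  have hmap : Submodule.span ℂ (Set.range (fourierLp (T := 1) 1)) =
      (Submodule.span ℂ (Set.range (fourier (T := 1)))).map
        (ContinuousMap.toLp (E := ℂ) 1 (AddCircle.haarAddCircle (T := 1)) ℂ).toLinearMap := by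
    rw [Submodule.map_span, ← Set.range_comp]
    rfl
  rw [hmap] at hs
  obtain ⟨ψ, hψ, rfl⟩ := hs
  refine ⟨ψ, hψ, ?_⟩
  have h1 : ∫ t in (0 : ℝ)..1, ‖φ t - ψ (t : UnitAddCircle)‖ =
      ∫ t in (0 : ℝ)..1, ‖g (t : UnitAddCircle) - ψ (t : UnitAddCircle)‖ := by
    rw [intervalIntegral.integral_of_le zero_le_one, intervalIntegral.integral_of_le zero_le_one]
    refine integral_congr_ae ?_
    filter_upwards [hφφ₀, ae_restrict_mem measurableSet_Ioc] with t ht ht'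
    rw [hge t ht', ht]
  have h2 := UnitAddCircle.intervalIntegral_preimage 0 fun z => ‖g z - ψ z‖
  rw [zero_add] at h2
  rw [h1, h2]
  have h3 : dist (hgL.toLp g) (ContinuousMap.toLp (E := ℂ) 1
      (AddCircle.haarAddCircle (T := 1)) ℂ ψ) =
      ∫ z, ‖g z - ψ z‖ ∂(AddCircle.haarAddCircle : Measure UnitAddCircle) := by
    rw [dist_eq_norm, L1.norm_eq_integral_norm]
    refine integral_congr_ae ?_
    filter_upwards [Lp.coeFn_sub (hgL.toLp g) (ContinuousMap.toLp (E := ℂ) 1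
      (AddCircle.haarAddCircle (T := 1)) ℂ ψ), hgL.coeFn_toLp,
      ContinuousMap.coeFn_toLp (p := 1) (𝕜 := ℂ) (AddCircle.haarAddCircle (T := 1)) ψ]
      with z h4 h5 h6
    rw [h4, Pi.sub_apply, h5, h6]
  rw [← hvol, ← h3]
  exact hsd.le

/-- The number of visits to a short arc, up to the inverse of its length, is equidistributed
against every integrable function. -/
theorem exists_abs_arcError_le (hαi : Irrational α) (hA : 0 < A)
    (hα : ∀ m : ℕ, 0 < m → ∀ k : ℤ, 1 ≤ A * m * |m * α - k|) {φ : ℝ → ℝ}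
    (hφ : IntervalIntegrable φ volume 0 1) {ξ : ℝ} (hξ : 0 < ξ) :
    ∃ τ₀ : ℝ, 0 < τ₀ ∧ ∀ (a τ : ℝ) (k : ℕ), 0 ≤ τ → τ < τ₀ → k * τ ≤ 1 →
      |arcError α a τ k φ| ≤ ξ := by
  have hφc : IntervalIntegrable (fun t => (φ t : ℂ)) volume 0 1 := by
    rw [intervalIntegrable_iff] at hφ ⊢
    exact hφ.ofReal
  obtain ⟨ψ, hψ, hφψ⟩ := exists_mem_span_fourier_integral_norm_sub_le hφc
    (η := ξ / (2 * (A + 2))) (by positivity)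
  obtain ⟨K, hK⟩ := exists_norm_arcError_le_of_mem_span hαi hψ
  -- Half of `ξ` pays for the trigonometric polynomial, the other half for the L¹ remainder.
  refine ⟨min 1 (ξ / (2 * (|K| + 1))), by positivity, fun a τ k hτ hτ₀ hk => ?_⟩
  have hτ1 : τ ≤ 1 := (hτ₀.trans_le (min_le_left _ _)).le
  have hτ2 : τ ≤ ξ / (2 * (|K| + 1)) := (hτ₀.trans_le (min_le_right _ _)).le
  have h1 : ((arcError α a τ k φ : ℝ) : ℂ) = arcError α a τ k (fun t => (φ t : ℂ)) := by
    simp only [arcError, smul_eq_mul, Complex.real_smul]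
    push_cast
    rw [← intervalIntegral.integral_ofReal, ← intervalIntegral.integral_ofReal]
    simp
  have h2 : arcError α a τ k (fun t => (φ t : ℂ)) =
      arcError α a τ k (fun t : ℝ => ψ (t : UnitAddCircle)) +
        arcError α a τ k (fun t : ℝ => (φ t : ℂ) - ψ (t : UnitAddCircle)) := by
    rw [← arcError_add (intervalIntegrable_coe ψ) (hφc.sub (intervalIntegrable_coe ψ))]
    congr 1
    ext t
    ring
  have h3 := hK a τ k hτ
  have h4 := norm_arcError_le (a := a) hA hα hτ hτ1 hk (hφc.sub (intervalIntegrable_coe ψ))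
  have h5 : (A + 2) * ∫ t in (0 : ℝ)..1, ‖(φ t : ℂ) - ψ (t : UnitAddCircle)‖ ≤ ξ / 2 := by
    calc _ ≤ (A + 2) * (ξ / (2 * (A + 2))) := by gcongr
      _ = ξ / 2 := by field_simp
  have h6 : K * τ ≤ ξ / 2 := by
    calc K * τ ≤ (|K| + 1) * τ := by
          gcongr
          linarith [le_abs_self K]
      _ ≤ (|K| + 1) * (ξ / (2 * (|K| + 1))) := by gcongr
      _ = ξ / 2 := by field_simp
  rw [← Real.norm_eq_abs, ← Complex.norm_real, h1, h2]
  refine (norm_add_le _ _).trans ?_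
  linarith

end Fourier

/-! ### Roof functions: jumps, primitives and Birkhoff sums -/

section Roof

variable {f : UnitAddCircle → ℝ} {β : ℕ → ℝ} {d : ℕ → ℝ}

theorem lift_add_one (f : UnitAddCircle → ℝ) (x : ℝ) : lift f (x + 1) = lift f x := by
  simp [lift]

theorem jump_eq_zero {y : ℝ} (h : ContinuousAt (lift f) y) : jump f y = 0 := by
  rw [jump, leftLim_eq_of_tendsto (h.tendsto.mono_left nhdsWithin_le_nhds),
    rightLim_eq_of_tendsto (h.tendsto.mono_left nhdsWithin_le_nhds), sub_self]

/-- A divergent `tsum` has the default value `0`, so `S ≠ 0` already forces summability. -/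
theorem summable_jump (h : sumJumps f ≠ 0) : Summable fun y : Set.Ico (0 : ℝ) 1 => jump f y := by
  by_contra hs
  exact h (tsum_eq_zero_of_not_summable hs)

theorem ListsDiscontinuities.support_subset (hβ : ListsDiscontinuities f β) {x : ℝ} (hx : x ≤ 1) :
    Function.support ((Set.Ico (0 : ℝ) x).indicator (jump f)) ⊆ Set.range β := by
  intro y hy
  have hy1 : y ∈ Set.Ico (0 : ℝ) x := by
    by_contra h
    exact hy (indicator_of_notMem h _)
  refine hβ.2.2 y ⟨hy1.1, hy1.2.trans_le hx⟩ fun hc => hy ?_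
  rw [indicator_of_mem hy1, jump_eq_zero hc]

theorem summable_of_jumps (hβ : ListsDiscontinuities f β) (hd : ∀ i, d i = jump f (β i))
    (h : sumJumps f ≠ 0) : Summable d := by
  have h1 := (summable_subtype_iff_indicator (f := jump f) (s := Set.Ico (0 : ℝ) 1)).1
    (summable_jump h)
  have h2 := h1.comp_injective hβ.2.1
  refine h2.congr fun i => ?_
  rw [Function.comp_apply, indicator_of_mem (hβ.1 i), hd]

theorem jumpPart_eq (hβ : ListsDiscontinuities f β) (hd : ∀ i, d i = jump f (β i)) {x : ℝ}
    (hx : x ≤ 1) : jumpPart f x = -∑' i, if β i < x then d i else 0 := by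
  rw [jumpPart, tsum_neg, tsum_subtype (Set.Ico (0 : ℝ) x) (jump f),
    ← hβ.2.1.tsum_eq (hβ.support_subset hx)]
  congr 1
  refine tsum_congr fun i => ?_
  by_cases h : β i < x
  · rw [if_pos h, indicator_of_mem (show β i ∈ Set.Ico (0 : ℝ) x from ⟨(hβ.1 i).1, h⟩), hd]
  · rw [if_neg h, indicator_of_notMem fun h' : β i ∈ Set.Ico (0 : ℝ) x => h h'.2]

theorem sumJumps_eq (hβ : ListsDiscontinuities f β) (hd : ∀ i, d i = jump f (β i)) :
    sumJumps f = ∑' i, d i := by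
  have h1 : sumJumps f = -jumpPart f 1 := by rw [jumpPart, tsum_neg, neg_neg]; rfl
  rw [h1, jumpPart_eq hβ hd le_rfl, neg_neg]
  exact tsum_congr fun i => if_pos (hβ.1 i).2

theorem summable_mul_ceil (hd : Summable d) (hβ : ∀ i, β i ∈ Set.Ico (0 : ℝ) 1) (b : ℝ) :
    Summable fun i => d i * ⌈b - β i⌉ := by
  refine Summable.of_norm_bounded (g := fun i => |d i| * (|b| + 2)) (hd.abs.mul_right _)
    fun i => ?_
  rw [Real.norm_eq_abs, abs_mul]
  refine mul_le_mul_of_nonneg_left ?_ (abs_nonneg _)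
  have h1 := Int.le_ceil (b - β i)
  have h2 := Int.ceil_lt_add_one (b - β i)
  have h3 := abs_le.1 (le_refl |b|)
  rw [abs_le]
  constructor <;> linarith [(hβ i).1, (hβ i).2]

/-- The derivative of the absolutely continuous part of the roof function. -/
def roofDeriv (f : UnitAddCircle → ℝ) : ℝ → ℝ := deriv fun x => lift f x - jumpPart f x

theorem intervalIntegrable_roofDeriv (hf : MemV f) :
    IntervalIntegrable (roofDeriv f) volume 0 1 :=
  hf.noSingularPart.intervalIntegrable_deriv

theorem integral_roofDeriv (hf : MemV f) {b : ℝ} (hb : b ∈ Icc (0 : ℝ) 1) :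
    ∫ t in (0 : ℝ)..b, roofDeriv f t = lift f b - jumpPart f b - lift f 0 := by
  have h1 : AbsolutelyContinuousOnInterval (fun x => lift f x - jumpPart f x) 0 b :=
    hf.noSingularPart.mono (by
      rw [uIcc_of_le hb.1, uIcc_of_le zero_le_one]
      exact Icc_subset_Icc_right hb.2)
  rw [roofDeriv, h1.integral_deriv_eq_sub]
  have h2 : jumpPart f 0 = 0 := by
    rw [jumpPart, Ico_self]
    exact tsum_empty
  rw [h2, sub_zero]

/-- Since `f(1) = f(0)`, the absolutely continuous part has to compensate the jumps. -/
theorem integral_roofDeriv_one (hf : MemV f) :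
    ∫ t in (0 : ℝ)..1, roofDeriv f t = sumJumps f := by
  have h1 : sumJumps f = -jumpPart f 1 := by rw [jumpPart, tsum_neg, neg_neg]; rfl
  have h2 := lift_add_one f 0
  rw [zero_add] at h2
  rw [integral_roofDeriv hf (by simp), h1, h2]
  ring

/-- The function `⌈b - β i⌉` is left-continuous like `f` and steps up by one just after `β i`; on
`[0, 1)` these steps reproduce `jumpPart`. Over a period the primitive gains `S` and the steps lose
`S`, in accordance with the periodicity of `f`. -/
theorem lift_eq (hf : MemV f) (hβ : ListsDiscontinuities f β) (hd : ∀ i, d i = jump f (β i))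
    (hS : sumJumps f ≠ 0) (b : ℝ) :
    lift f b = lift f 0 + ceilPrimitive (roofDeriv f) b - ∑' i, d i * ⌈b - β i⌉ := by
  have hds := summable_of_jumps hβ hd hS
  have h := eq_ceilPrimitive (intervalIntegrable_roofDeriv hf)
    (H := fun b => lift f b - lift f 0 + ∑' i, d i * ⌈b - β i⌉) ?_ ?_ b
  · rw [← h]
    ring
  · intro b
    have h1 : ∑' i, d i * (⌈b + 1 - β i⌉ : ℝ) = ∑' i, d i * (⌈b - β i⌉ : ℝ) + ∑' i, d i := by
      rw [← (summable_mul_ceil hds hβ.1 b).tsum_add hds]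
      refine tsum_congr fun i => ?_
      rw [show b + 1 - β i = b - β i + 1 by ring, Int.ceil_add_one]
      push_cast
      ring
    rw [lift_add_one, integral_roofDeriv_one hf, sumJumps_eq hβ hd, h1]
    ring
  · intro b hb
    rw [integral_roofDeriv hf (Ico_subset_Icc_self hb), jumpPart_eq hβ hd hb.2.le]
    have h1 : ∑' i, d i * (⌈b - β i⌉ : ℝ) = ∑' i, if β i < b then d i else 0 := by
      refine tsum_congr fun i => ?_
      have h2 := hβ.1 i
      split_ifs with h3
      · have : ⌈b - β i⌉ = 1 := by
          rw [Int.ceil_eq_iff]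
          push_cast
          constructor <;> linarith [h2.1, hb.2]
        simp [this]
      · have : ⌈b - β i⌉ = 0 := by
          rw [Int.ceil_eq_iff]
          push_cast
          constructor <;> linarith [h2.2, hb.1]
        simp [this]
    rw [h1]
    ring

theorem addRight_zpow_apply {G : Type*} [AddCommGroup G] (a : G) (n : ℤ) (x : G) :
    (Equiv.addRight a ^ n) x = x + n • a := by
  simp

theorem cocycle_addRight (α a : ℝ) (f : UnitAddCircle → ℝ) (k : ℕ) :
    cocycle (Equiv.addRight (α : UnitAddCircle)) f k (a : UnitAddCircle) =
      ∑ l ∈ Finset.range k, lift f (a + l * α) := by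
  rw [cocycle_natCast]
  refine Finset.sum_congr rfl fun l _ => ?_
  have h := addRight_zpow_apply (α : UnitAddCircle) l (a : UnitAddCircle)
  rw [zpow_natCast] at h
  rw [h, lift]
  simp

theorem summable_mul_arcCount (hd : Summable d) (hβ : ∀ i, β i ∈ Set.Ico (0 : ℝ) 1)
    (α a τ : ℝ) (k : ℕ) : Summable fun i => d i * arcCount α a τ k (β i) := by
  simp only [arcCount, Int.cast_sum, Int.cast_sub, Finset.mul_sum, mul_sub]
  exact summable_sum fun l _ => (summable_mul_ceil hd hβ _).sub (summable_mul_ceil hd hβ _)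

/-- The difference of the Birkhoff sums of the roof function at the ends of a short arc. -/
theorem cocycle_sub_cocycle (hf : MemV f) (hβ : ListsDiscontinuities f β)
    (hd : ∀ i, d i = jump f (β i)) (hS : sumJumps f ≠ 0) (α a τ : ℝ) (k : ℕ) :
    cocycle (Equiv.addRight (α : UnitAddCircle)) f k ((a + τ : ℝ) : UnitAddCircle) -
        cocycle (Equiv.addRight (α : UnitAddCircle)) f k (a : UnitAddCircle) =
      k * τ * sumJumps f + arcError α a τ k (roofDeriv f) -
        ∑' i, d i * arcCount α a τ k (β i) := by
  have hds := summable_of_jumps hβ hd hS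
  have hs := summable_mul_ceil hds hβ.1
  rw [arcError, integral_arcCount_smul α a τ (intervalIntegrable_roofDeriv hf),
    integral_roofDeriv_one hf, smul_eq_mul, cocycle_addRight, cocycle_addRight,
    ← Finset.sum_sub_distrib]
  have h1 : ∑' i, d i * (arcCount α a τ k (β i) : ℝ) = ∑ l ∈ Finset.range k,
      (∑' i, d i * (⌈a + l * α + τ - β i⌉ : ℝ) - ∑' i, d i * (⌈a + l * α - β i⌉ : ℝ)) := by
    simp only [arcCount, Int.cast_sum, Int.cast_sub, Finset.mul_sum, mul_sub]
    rw [Summable.tsum_finsetSum fun l _ => (hs _).sub (hs _)]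
    exact Finset.sum_congr rfl fun l _ => (hs _).tsum_sub (hs _)
  rw [h1, add_sub_cancel, ← Finset.sum_sub_distrib]
  refine Finset.sum_congr rfl fun l _ => ?_
  rw [show a + τ + l * α = a + l * α + τ by ring, lift_eq hf hβ hd hS (a + l * α + τ),
    lift_eq hf hβ hd hS (a + l * α)]
  ring

theorem measurable_roof (hf : MemV f) : Measurable f := by
  obtain ⟨p, q, hp, hq, hpq⟩ :=
    hf.boundedVariation.locallyBoundedVariationOn.exists_monotoneOn_sub_monotoneOn
  let e := AddCircle.measurableEquivIoc (1 : ℝ) 0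
  have hIoc : Ioc (0 : ℝ) (0 + 1) ⊆ Icc 0 1 := by
    rw [zero_add]
    exact Ioc_subset_Icc_self
  have hmono : ∀ p : ℝ → ℝ, MonotoneOn p (Icc 0 1) →
      Measurable fun t : Ioc (0 : ℝ) (0 + 1) => p t := fun p hp =>
    Monotone.measurable fun s t hst => hp (hIoc s.2) (hIoc t.2) hst
  have h1 : Measurable fun t : Ioc (0 : ℝ) (0 + 1) => p t - q t := (hmono p hp).sub (hmono q hq)
  have h2 : f = (fun t : Ioc (0 : ℝ) (0 + 1) => p t - q t) ∘ e := by
    ext z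
    have h3 : ((e z : ℝ) : UnitAddCircle) = z := (AddCircle.equivIoc (1 : ℝ) 0).symm_apply_apply z
    have h4 : lift f (e z) = p (e z) - q (e z) := by rw [hpq]; rfl
    rw [Function.comp_apply, ← h4, lift, h3]
  rw [h2]
  exact h1.comp e.measurable

theorem exists_roof_le (hf : MemV f) : ∃ F : ℝ, ∀ x, f x ≤ F := by
  refine ⟨lift f 0 + (eVariationOn (lift f) (Icc 0 1)).toReal, fun x => ?_⟩
  obtain ⟨y, rfl⟩ := QuotientAddGroup.mk_surjective x
  obtain ⟨z, hz, hyz⟩ := (show Function.Periodic (lift f) 1 from lift_add_one f).exists_mem_Ico₀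
    one_pos y
  have h1 := hf.boundedVariation.dist_le (Ico_subset_Icc_self hz)
    (show (0 : ℝ) ∈ Icc (0 : ℝ) 1 by simp)
  rw [Real.dist_eq] at h1
  have h2 := le_abs_self (lift f z - lift f 0)
  change lift f y ≤ _
  rw [hyz]
  linarith

end Roof

/-! ### Windows where the Birkhoff sums differ by a constant shift -/

section BaseWindow

/-- Pigeonhole: if the counter grew on each of the `R + 1` consecutive blocks of length `K'`, it
would exceed `R`. -/
theorem exists_eq_of_monotone_of_le {Φ : ℕ → ℤ} (hΦ : Monotone Φ) (K₀ K' R : ℕ) (h0 : 0 ≤ Φ K₀)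
    (hR : Φ (K₀ + (R + 1) * K') ≤ R) :
    ∃ j ≤ R, Φ (K₀ + j * K') = Φ (K₀ + j * K' + K') := by
  by_contra! h
  have h1 : ∀ j ≤ R + 1, (j : ℤ) ≤ Φ (K₀ + j * K') := by
    intro j
    induction j with
    | zero => intro _; simpa using h0
    | succ j ih =>
      intro hj
      have h2 := ih (by omega)
      have h3 := h j (by omega)
      have h4 := hΦ (show K₀ + j * K' ≤ K₀ + j * K' + K' by omega)
      rw [show K₀ + (j + 1) * K' = K₀ + j * K' + K' by ring]
      push_cast
      omega
  have := h1 (R + 1) le_rfl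
  push_cast at this
  omega

theorem abs_tsum_mul_sub_le {d : ℕ → ℝ} (hd : Summable d) {u v : ℕ → ℝ} {B : ℝ} {m : ℕ}
    (hu : Summable fun i => d i * u i) (hv : Summable fun i => d i * v i)
    (heq : ∀ i < m, u i = v i) (hB : ∀ i, |u i - v i| ≤ B) :
    |∑' i, d i * u i - ∑' i, d i * v i| ≤ B * ∑' i, |d (i + m)| := by
  have h1 := hu.sub hv
  rw [← hu.tsum_sub hv, ← h1.sum_add_tsum_nat_add m, Finset.sum_eq_zero, zero_add]
  · have hs : Summable fun i => |d (i + m)| := (summable_nat_add_iff m).2 hd.abs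
    rw [← tsum_mul_left, ← Real.norm_eq_abs]
    refine tsum_of_norm_bounded (hs.mul_left B).hasSum fun i => ?_
    rw [Real.norm_eq_abs, ← mul_sub, abs_mul, mul_comm]
    exact mul_le_mul_of_nonneg_right (hB _) (abs_nonneg _)
  · intro i hi
    rw [heq i (Finset.mem_range.1 hi), sub_self]

variable {f : UnitAddCircle → ℝ} {β : ℕ → ℝ} {d : ℕ → ℝ} {α A : ℝ}

/-- While `k |S| τ` runs through `[p - ξ', p]` the drift is nearly `sgn(S) p`, and the counts for
the first `m` jumps are constant on a long block. The sum `r` uses the counts of all jumps at the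
start `K` of the block, so it belongs exactly to the set of admissible sums. -/
theorem exists_window_cocycle_sub (hf : MemV f) (hβ : ListsDiscontinuities f β)
    (hd : ∀ i, d i = jump f (β i)) (hS : sumJumps f ≠ 0) (hαi : Irrational α) (hA : 0 < A)
    (hα : ∀ m : ℕ, 0 < m → ∀ k : ℤ, 1 ≤ A * m * |m * α - k|) {p : ℝ} (hp : 0 < p)
    (hpS : p ≤ |sumJumps f|) {ξ : ℝ} (hξ : 0 < ξ) :
    ∃ κ τ₀ : ℝ, 0 < κ ∧ 0 < τ₀ ∧ ∀ τ : ℝ, 0 < τ → τ < τ₀ → ∀ a : ℝ,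
      ∃ (K K' : ℕ) (n : ℕ → ℕ) (r : ℝ), (∀ i, (n i : ℝ) < A + 1) ∧
        HasSum (fun i => (n i : ℝ) * d i) r ∧
        K * τ ≤ 1 ∧ κ ≤ K * τ ∧ κ ≤ K' * τ ∧ ∀ k : ℕ, K ≤ k → k ≤ K + K' →
          |cocycle (Equiv.addRight (α : UnitAddCircle)) f k ((a + τ : ℝ) : UnitAddCircle) -
            cocycle (Equiv.addRight (α : UnitAddCircle)) f k (a : UnitAddCircle) -
            (Real.sign (sumJumps f) * p - r)| ≤ ξ := by
  have hds := summable_of_jumps hβ hd hS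
  set S := sumJumps f with hSdef
  have hS0 : 0 < |S| := abs_pos.2 hS
  obtain ⟨m, hm⟩ : ∃ m : ℕ, (A + 1) * ∑' i, |d (i + m)| ≤ ξ / 3 := by
    have h1 : Tendsto (fun m : ℕ => (A + 1) * ∑' i, |d (i + m)|) atTop (𝓝 ((A + 1) * 0)) :=
      (tendsto_sum_nat_add fun i => |d i|).const_mul _
    rw [mul_zero] at h1
    exact ((h1.eventually (gt_mem_nhds (show 0 < ξ / 3 by positivity))).exists).imp
      fun m hm => hm.le
  obtain ⟨τ₁, hτ₁, hE⟩ := exists_abs_arcError_le hαi hA hα (intervalIntegrable_roofDeriv hf)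
    (show 0 < ξ / 3 by positivity)
  -- The bound `p / 2` keeps `K |S| τ` at least `p / 2`, which gives the first entry of `κ`.
  set ξ' := min (ξ / 3) (p / 2) with hξ'
  have hξ'0 : 0 < ξ' := by positivity
  have hξ'1 : ξ' ≤ ξ / 3 := min_le_left _ _
  have hξ'2 : ξ' ≤ p / 2 := min_le_right _ _
  -- An upper bound for the total count of the first `m` jumps, hence for the number of blocks on
  -- which it can change.
  set R := m * ⌊A + 1⌋₊ with hR
  have hR0 : (0 : ℝ) < R + 1 := by positivity
  refine ⟨min (p / (2 * |S|)) (ξ' / (2 * |S| * (R + 1))),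
    min (min 1 τ₁) (ξ' / (4 * |S| * (R + 1))), by positivity, by positivity,
    fun τ hτ hττ a => ?_⟩
  have hτ1 : τ ≤ 1 := (hττ.trans_le ((min_le_left _ _).trans (min_le_left _ _))).le
  have hττ₁ : τ < τ₁ := hττ.trans_le ((min_le_left _ _).trans (min_le_right _ _))
  have hττ₂ : τ * (4 * |S| * (R + 1)) ≤ ξ' :=
    (le_div_iff₀ (by positivity)).1 (hττ.trans_le (min_le_right _ _)).le
  have hSτ : 0 < |S| * τ := by positivity
  -- `K₀` is the first `k` with `k |S| τ ≥ p - ξ'`, and `R + 1` blocks of length `K'` must end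
  -- before `k |S| τ` exceeds `p`; the `-1` in `y` pays for the ceiling in `K₀`.
  set K₀ := ⌈(p - ξ') / (|S| * τ)⌉₊ with hK₀
  set y := (ξ' / (|S| * τ) - 1) / (R + 1) with hy
  set K' := ⌊y⌋₊ with hK'
  have hy0 : 0 ≤ y := by
    refine div_nonneg ?_ hR0.le
    rw [sub_nonneg, le_div_iff₀ hSτ]
    have : |S| * τ * 1 ≤ |S| * τ * (4 * (R + 1)) := by
      have : (0 : ℝ) ≤ R := by positivity
      gcongr
      linarith
    nlinarith
  have hK₀1 : (p - ξ') ≤ K₀ * (|S| * τ) := by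
    rw [← div_le_iff₀ hSτ]
    exact Nat.le_ceil _
  have hend : ((K₀ + (R + 1) * K' : ℕ) : ℝ) * (|S| * τ) ≤ p := by
    have h1 : (K₀ : ℝ) < (p - ξ') / (|S| * τ) + 1 := Nat.ceil_lt_add_one (by
      have : 0 ≤ p - ξ' := by linarith
      positivity)
    have h2 : (K' : ℝ) ≤ y := Nat.floor_le hy0
    have h3 : ((R : ℝ) + 1) * K' ≤ ξ' / (|S| * τ) - 1 := by
      calc ((R : ℝ) + 1) * K' ≤ (R + 1) * y := by gcongr
        _ = _ := by rw [hy]; field_simp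
    rw [← le_div_iff₀ hSτ]
    push_cast
    have h4 : p / (|S| * τ) = (p - ξ') / (|S| * τ) + ξ' / (|S| * τ) := by ring
    linarith
  have hkτ : ∀ k : ℕ, k ≤ K₀ + (R + 1) * K' → (k : ℝ) * (|S| * τ) ≤ p ∧ (k : ℝ) * τ ≤ 1 := by
    intro k hk
    have h1 : (k : ℝ) ≤ ((K₀ + (R + 1) * K' : ℕ) : ℝ) := by exact_mod_cast hk
    have h2 : (k : ℝ) * (|S| * τ) ≤ p := le_trans (by gcongr) hend
    refine ⟨h2, ?_⟩
    have h3 : (k : ℝ) * τ * |S| ≤ 1 * |S| := by linarith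
    exact le_of_mul_le_mul_right h3 hS0
  set cnt : ℕ → ℕ → ℤ := fun k i => arcCount α a τ k (β i) with hcnt
  have hcnt0 : ∀ k i, 0 ≤ cnt k i := fun k i => arcCount_nonneg hτ.le k _
  have hcntA : ∀ k, k ≤ K₀ + (R + 1) * K' → ∀ i, (cnt k i : ℝ) < A + 1 := fun k hk i =>
    arcCount_lt hA hα hτ1 (hkτ k hk).2 _
  set Φ : ℕ → ℤ := fun k => ∑ i ∈ Finset.range m, cnt k i with hΦ
  have hΦm : Monotone Φ := fun k k' h => Finset.sum_le_sum fun i _ => arcCount_mono hτ.le _ h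
  obtain ⟨j, hj, hΦj⟩ := exists_eq_of_monotone_of_le hΦm K₀ K' R
    (Finset.sum_nonneg fun i _ => hcnt0 _ _) (by
      have h1 : Φ (K₀ + (R + 1) * K') ≤ ∑ i ∈ Finset.range m, (⌊A + 1⌋₊ : ℤ) := by
        refine Finset.sum_le_sum fun i _ => ?_
        have h2 := hcntA _ le_rfl i
        have h3 : ((cnt (K₀ + (R + 1) * K') i).toNat : ℤ) = cnt (K₀ + (R + 1) * K') i :=
          Int.toNat_of_nonneg (hcnt0 _ _)
        rw [← h3]
        have h4 : (cnt (K₀ + (R + 1) * K') i).toNat ≤ ⌊A + 1⌋₊ := by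
          refine Nat.le_floor ?_
          have h5 : (((cnt (K₀ + (R + 1) * K') i).toNat : ℤ) : ℝ) < A + 1 := by rwa [h3]
          exact_mod_cast h5.le
        exact_mod_cast h4
      simpa [hR] using h1)
  set K := K₀ + j * K' with hK
  have hKle : K + K' ≤ K₀ + (R + 1) * K' := by
    rw [hK, add_assoc, ← Nat.succ_mul]
    exact Nat.add_le_add_left (Nat.mul_le_mul_right K' (by omega)) K₀
  -- The total is constant on the block and each count is monotone, so each count is constant.
  have hconst : ∀ k, K ≤ k → k ≤ K + K' → ∀ i < m, cnt k i = cnt K i := by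
    intro k hk hk' i hi
    have h1 : ∀ i ∈ Finset.range m, cnt K i ≤ cnt (K + K') i := fun i _ =>
      arcCount_mono hτ.le _ (Nat.le_add_right _ _)
    have h2 := (Finset.sum_eq_sum_iff_of_le h1).1 hΦj i (Finset.mem_range.2 hi)
    have h3 : cnt K i ≤ cnt k i := arcCount_mono hτ.le _ hk
    have h4 : cnt k i ≤ cnt (K + K') i := arcCount_mono hτ.le _ hk'
    omega
  have hsum : ∀ k, Summable fun i => d i * (cnt k i : ℝ) := fun k =>
    summable_mul_arcCount hds hβ.1 α a τ k
  have hnat : ∀ i, (((cnt K i).toNat : ℕ) : ℝ) = cnt K i := by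
    intro i
    exact_mod_cast congrArg (Int.cast (R := ℝ)) (Int.toNat_of_nonneg (hcnt0 K i))
  refine ⟨K, K', fun i => (cnt K i).toNat, ∑' i, d i * (cnt K i : ℝ), fun i => ?_, ?_,
    (hkτ K (by omega)).2, ?_, ?_, fun k hk hk' => ?_⟩
  · rw [hnat]
    exact hcntA K (by omega) i
  · simp only [hnat, mul_comm _ (d _)]
    exact (hsum K).hasSum
  · refine (min_le_left _ _).trans ?_
    rw [div_le_iff₀ (by positivity)]
    have h1 : (K₀ : ℝ) ≤ K := by exact_mod_cast Nat.le_add_right _ _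
    have h2 : (K₀ : ℝ) * (|S| * τ) ≤ K * (|S| * τ) := by gcongr
    linarith
  · refine (min_le_right _ _).trans ?_
    rw [div_le_iff₀ (by positivity)]
    have h1 : y < K' + 1 := Nat.lt_floor_add_one y
    have h2 : ξ' = (y * (R + 1) + 1) * (|S| * τ) := by
      rw [hy]
      field_simp
      ring
    have h3 : (y * (R + 1) + 1) * (|S| * τ) ≤ ((K' + 1) * (R + 1) + 1) * (|S| * τ) := by gcongr
    have h4 : (0 : ℝ) ≤ R * (|S| * τ) := by positivity
    nlinarith
  · have h1 := cocycle_sub_cocycle hf hβ hd hS α a τ k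
    have hkend : k ≤ K₀ + (R + 1) * K' := by omega
    have h2 := hE a τ k hτ.le hττ₁ (hkτ k hkend).2
    have h3 := abs_tsum_mul_sub_le hds (hsum k) (hsum K) (B := A + 1) (m := m)
      (fun i hi => by rw [hconst k hk hk' i hi]) (fun i => by
        have h4 : cnt K i ≤ cnt k i := arcCount_mono hτ.le _ hk
        have h5 := hcntA k hkend i
        have h6 : (0 : ℝ) ≤ cnt K i := by exact_mod_cast hcnt0 K i
        have h7 : (cnt K i : ℝ) ≤ cnt k i := by exact_mod_cast h4
        rw [abs_of_nonneg (by linarith)]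
        linarith)
    have h8 : |k * τ * S - Real.sign S * p| ≤ ξ / 3 := by
      have h9 : k * τ * S - Real.sign S * p = Real.sign S * (k * (|S| * τ) - p) := by
        have : S = Real.sign S * |S| := by
          rcases lt_or_gt_of_ne hS with h | h
          · rw [Real.sign_of_neg h, abs_of_neg h]
            ring
          · rw [Real.sign_of_pos h, abs_of_pos h, one_mul]
        calc k * τ * S - Real.sign S * p = k * τ * (Real.sign S * |S|) - Real.sign S * p := by
              rw [← this]
          _ = _ := by ring
      have h10 : |Real.sign S| = 1 := by
        rcases Real.sign_apply_eq_of_ne_zero S hS with h | h <;> simp [h]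
      have h11 : (K₀ : ℝ) ≤ k := by
        have : K₀ ≤ k := le_trans (Nat.le_add_right _ _) hk
        exact_mod_cast this
      have h12 : (K₀ : ℝ) * (|S| * τ) ≤ k * (|S| * τ) := by gcongr
      have h13 := (hkτ k hkend).1
      rw [h9, abs_mul, h10, one_mul, abs_le]
      constructor <;> linarith
    rw [h1]
    have h14 : k * τ * S + arcError α a τ k (roofDeriv f) - ∑' i, d i * (cnt k i : ℝ) -
        (Real.sign S * p - ∑' i, d i * (cnt K i : ℝ)) =
        (k * τ * S - Real.sign S * p) + arcError α a τ k (roofDeriv f) -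
        (∑' i, d i * (cnt k i : ℝ) - ∑' i, d i * (cnt K i : ℝ)) := by ring
    rw [h14]
    refine (abs_sub _ _).trans ?_
    have h15 := abs_add_le (k * τ * S - Real.sign S * p) (arcError α a τ k (roofDeriv f))
    linarith

end BaseWindow

/-! ### From the base to the special flow -/

section NearBoundary

variable {X : Type*} {f : X → ℝ} {c w : ℝ}

/-- The points at distance less than `w` from the floor or at most `w` from the roof. -/
def nearBoundary (f : X → ℝ) (w : ℝ) : Set (Space f) :=
  (fun q : Space f => q.1) ⁻¹' {y | y.2 < w ∨ f y.1 - w ≤ y.2}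

variable [MeasureSpace X]

theorem measurableSet_nearBoundary (hf : Measurable f) : MeasurableSet (nearBoundary f w) :=
  measurable_val ((measurableSet_lt measurable_snd measurable_const).union
    (measurableSet_le ((hf.comp measurable_fst).sub_const w) measurable_snd))

variable [IsProbabilityMeasure (volume : Measure X)]

theorem restrictedMeasure_nearBoundary_le (hf : Measurable f) (hw : 0 ≤ w) :
    restrictedMeasure f (nearBoundary f w) ≤ ENNReal.ofReal (2 * w) := by
  have hS : MeasurableSet {y : X × ℝ | y.2 < w ∨ f y.1 - w ≤ y.2} :=
    (measurableSet_lt measurable_snd measurable_const).union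
      (measurableSet_le ((hf.comp measurable_fst).sub_const w) measurable_snd)
  rw [nearBoundary, restrictedMeasure_preimage hf, Measure.volume_eq_prod,
    Measure.prod_apply (hS.inter (measurableSet_range_val hf))]
  have h1 : ∀ x : X, volume (Prod.mk x ⁻¹' ({y : X × ℝ | y.2 < w ∨ f y.1 - w ≤ y.2} ∩
      {y : X × ℝ | 0 ≤ y.2 ∧ y.2 < f y.1})) ≤ ENNReal.ofReal (2 * w) := by
    intro x
    have h2 : Prod.mk x ⁻¹' ({y : X × ℝ | y.2 < w ∨ f y.1 - w ≤ y.2} ∩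
        {y : X × ℝ | 0 ≤ y.2 ∧ y.2 < f y.1}) ⊆ Ico 0 w ∪ Ico (f x - w) (f x) := by
      rintro s ⟨hs1 | hs1, hs2⟩
      · exact Or.inl ⟨hs2.1, hs1⟩
      · exact Or.inr ⟨hs1, hs2.2⟩
    refine (measure_mono h2).trans ((measure_union_le _ _).trans ?_)
    rw [Real.volume_Ico, Real.volume_Ico, ← ENNReal.ofReal_add (by linarith) (by linarith)]
    exact ENNReal.ofReal_le_ofReal (by linarith)
  exact (lintegral_mono h1).trans (by simp)

theorem ofReal_le_restrictedMeasure_univ (hfm : Measurable f) (hf : ∀ x, c ≤ f x) :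
    ENNReal.ofReal c ≤ restrictedMeasure f univ := by
  rw [restrictedMeasure_univ_eq hfm]
  calc ENNReal.ofReal c = ∫⁻ _ : X, ENNReal.ofReal c := by simp
    _ ≤ _ := lintegral_mono fun x => ENNReal.ofReal_le_ofReal (hf x)

theorem restrictedMeasure_univ_ne_top (hfm : Measurable f) {F : ℝ} (hF : ∀ x, f x ≤ F) :
    restrictedMeasure f univ ≠ ⊤ := by
  rw [restrictedMeasure_univ_eq hfm]
  refine ne_top_of_le_ne_top (b := ENNReal.ofReal F) ENNReal.ofReal_ne_top ?_
  calc _ ≤ ∫⁻ _ : X, ENNReal.ofReal F := lintegral_mono fun x => ENNReal.ofReal_le_ofReal (hF x)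
    _ = _ := by simp

theorem isProbabilityMeasure_flowMeasure (hfm : Measurable f) (hc : 0 < c) (hf : ∀ x, c ≤ f x)
    {F : ℝ} (hF : ∀ x, f x ≤ F) : IsProbabilityMeasure (flowMeasure f) := by
  refine ⟨?_⟩
  rw [flowMeasure, Measure.smul_apply, smul_eq_mul]
  refine ENNReal.inv_mul_cancel ?_ (restrictedMeasure_univ_ne_top hfm hF)
  exact ((ENNReal.ofReal_pos.2 hc).trans_le (ofReal_le_restrictedMeasure_univ hfm hf)).ne'

theorem flowMeasure_real_nearBoundary_le (hfm : Measurable f) (hc : 0 < c) (hf : ∀ x, c ≤ f x)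
    (hw : 0 ≤ w) : (flowMeasure f).real (nearBoundary f w) ≤ 2 * w / c := by
  rw [measureReal_def, flowMeasure, Measure.smul_apply, smul_eq_mul]
  refine ENNReal.toReal_le_of_le_ofReal (by positivity) ?_
  rw [ENNReal.ofReal_div_of_pos hc, div_eq_mul_inv, mul_comm]
  gcongr
  · exact restrictedMeasure_nearBoundary_le hfm hw
  · exact ofReal_le_restrictedMeasure_univ hfm hf

end NearBoundary

/-! ### Closeness of orbits, and return counts turned into times -/

section Transfer

variable {f : UnitAddCircle → ℝ} {α c : ℝ}

/-- If the Birkhoff sums at `q` and `q'` differ nearly by `ρ` then, away from the boundary, the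
orbit of `q'` follows the one of `q` with the time shift `ρ`. -/
theorem dist_specialFlow_lt (hc : 0 < c) (hf : ∀ x, c ≤ f x) {w ρ t : ℝ} {K K' : ℕ}
    {q q' : Space f} (hqq : dist q q' < w / 4)
    (hρ : ∀ k : ℕ, K ≤ k → k ≤ K + K' →
      |cocycle (Equiv.addRight (α : UnitAddCircle)) f k q'.1.1 -
        cocycle (Equiv.addRight (α : UnitAddCircle)) f k q.1.1 - ρ| ≤ w / 4)
    (hK : cocycle (Equiv.addRight (α : UnitAddCircle)) f K q.1.1 ≤ q.1.2 + t)
    (hK' : q.1.2 + t < cocycle (Equiv.addRight (α : UnitAddCircle)) f (K + K' : ℕ) q.1.1)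
    (hB : specialFlow (Equiv.addRight (α : UnitAddCircle)) f t q ∉ nearBoundary f w) :
    dist (specialFlow (Equiv.addRight (α : UnitAddCircle)) f t q)
      (specialFlow (Equiv.addRight (α : UnitAddCircle)) f (t + ρ) q') < w := by
  set T := Equiv.addRight (α : UnitAddCircle) with hT
  have hqq' : dist q q' = dist q.1.1 q'.1.1 + |q.1.2 - q'.1.2| := rfl
  have hd0 : 0 ≤ dist q.1.1 q'.1.1 := dist_nonneg
  have hs : |q.1.2 - q'.1.2| < w / 4 := by linarith
  have hs' := abs_lt.1 hs
  obtain ⟨n, ⟨hn1, hn2⟩, hn⟩ := specialFlow_spec (T := T) hc hf t q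
  have hnK : (K : ℤ) ≤ n := by
    by_contra! h
    have := cocycle_mono (T := T) hc hf (show n + 1 ≤ K by omega) q.1.1
    linarith
  have hnK' : n < (K + K' : ℕ) := by
    by_contra! h
    have := cocycle_mono (T := T) hc hf h q.1.1
    linarith
  lift n to ℕ using (by omega) with k
  have h1 := abs_le.1 (hρ k (by omega) (by omega))
  -- The number of returns satisfies `k < K + K'`, so the estimate is also available at `k + 1`.
  have h2 := abs_le.1 (hρ (k + 1) (by omega) (by omega))
  push_cast at h2
  simp only [nearBoundary, mem_preimage, hn, mem_ofPred_eq, not_or, not_lt, not_le] at hB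
  have h3 := cocycle_succ T f k q.1.1
  -- Heights differ by at most `w / 4 + w / 4`, less than the distance `w` to floor and roof; so
  -- `q'` has made exactly `k` returns by time `t + ρ`.
  have hq' := specialFlow_eq (T := T) (t := t + ρ) (q := q') (n := k) hc hf
    ⟨by linarith, by linarith⟩
  change dist (specialFlow T f t q).1.1 (specialFlow T f (t + ρ) q').1.1 +
    |(specialFlow T f t q).1.2 - (specialFlow T f (t + ρ) q').1.2| < w
  rw [hn, hq']
  have h4 : dist ((T ^ (k : ℤ)) q.1.1) ((T ^ (k : ℤ)) q'.1.1) = dist q.1.1 q'.1.1 := by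
    rw [hT, addRight_zpow_apply, addRight_zpow_apply, dist_add_right]
  have h5 : |q.1.2 + t - cocycle T f k q.1.1 - (q'.1.2 + (t + ρ) - cocycle T f k q'.1.1)| ≤
      |q.1.2 - q'.1.2| + w / 4 := by
    have h6 : q.1.2 + t - cocycle T f k q.1.1 - (q'.1.2 + (t + ρ) - cocycle T f k q'.1.1) =
        (q.1.2 - q'.1.2) + (cocycle T f k q'.1.1 - cocycle T f k q.1.1 - ρ) := by ring
    rw [h6]
    exact (abs_add_le _ _).trans (by gcongr; exact abs_le.2 h1)
  simp only [h4]
  linarith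

theorem cocycle_natCast_le {X : Type*} {T : Equiv.Perm X} {f : X → ℝ} {F : ℝ} (hF : ∀ x, f x ≤ F)
    (n : ℕ) (x : X) : cocycle T f n x ≤ F * n := by
  rw [cocycle_natCast]
  have h := Finset.sum_le_card_nsmul (Finset.range n) (fun i => f ((T ^ i) x)) F fun i _ => hF _
  simpa [mul_comm] using h

/-- The number of good times in a window. -/
theorem lt_ncard_of_birkhoffSum_le {X : Type*} {U : X → X} {B : Set X} {q : X} {ε : ℝ} {M L : ℕ}
    (hL : 0 < L) (hB : birkhoffSum U (B.indicator 1) (L + 1) (U^[M] q) ≤ ε * L) {p : ℤ → Prop}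
    (hp : ∀ n : ℕ, M ≤ n → n ≤ M + L → U^[n] q ∉ B → p n) :
    1 - ε < (1 / (L : ℝ)) * (Set.ncard {n : ℤ | (M : ℤ) ≤ n ∧ n ≤ M + L ∧ p n} : ℝ) := by
  classical
  have hL' : (0 : ℝ) < L := by exact_mod_cast hL
  set G := (Finset.range (L + 1)).filter fun i => U^[i] (U^[M] q) ∉ B with hG
  have h1 : birkhoffSum U (B.indicator (1 : X → ℝ)) (L + 1) (U^[M] q) =
      ((Finset.range (L + 1)).filter fun i => U^[i] (U^[M] q) ∈ B).card := by
    rw [Finset.card_filter, birkhoffSum]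
    push_cast
    refine Finset.sum_congr rfl fun i _ => ?_
    by_cases h : U^[i] (U^[M] q) ∈ B <;> simp [h]
  have h2 : ((Finset.range (L + 1)).filter fun i => U^[i] (U^[M] q) ∈ B).card + G.card = L + 1 := by
    rw [hG, Finset.card_filter_add_card_filter_not, Finset.card_range]
  have h3 : G.card ≤ Set.ncard {n : ℤ | (M : ℤ) ≤ n ∧ n ≤ M + L ∧ p n} := by
    have hinj : Set.InjOn (fun i : ℕ => ((M + i : ℕ) : ℤ)) (G : Set ℕ) := by
      intro i _ j _ h
      simp only [Nat.cast_inj] at h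
      omega
    rw [← Set.ncard_coe_finset, ← hinj.ncard_image]
    refine Set.ncard_le_ncard ?_
      ((Set.finite_Icc (M : ℤ) (M + L)).subset fun n hn => ⟨hn.1, hn.2.1⟩)
    rintro _ ⟨i, hi, rfl⟩
    have hi' := Finset.mem_filter.1 hi
    have hi1 := Finset.mem_range.1 hi'.1
    refine ⟨by push_cast; omega, by push_cast; omega, hp _ (by omega) (by omega) ?_⟩
    rw [add_comm, Function.iterate_add_apply]
    exact hi'.2
  -- The window contains `L + 1` integers; the extra one makes the final inequality strict.
  have h4 : (L : ℝ) + 1 - ε * L ≤ G.card := by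
    have h5 : (((Finset.range (L + 1)).filter fun i => U^[i] (U^[M] q) ∈ B).card : ℝ) + G.card =
        L + 1 := by exact_mod_cast h2
    linarith
  have h6 : (G.card : ℝ) ≤ (Set.ncard {n : ℤ | (M : ℤ) ≤ n ∧ n ≤ M + L ∧ p n} : ℝ) := by
    exact_mod_cast h3
  rw [one_div_mul_eq_div, lt_div_iff₀ hL']
  linarith

theorem exists_abs_eq_dist (x x' : UnitAddCircle) :
    ∃ t : ℝ, |t| = dist x x' ∧ x' = x + (t : UnitAddCircle) := by
  obtain ⟨y, hy⟩ := QuotientAddGroup.mk_surjective (x' - x)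
  have hy' : (y : UnitAddCircle) = x' - x := hy
  refine ⟨y - round y, ?_, ?_⟩
  · rw [dist_comm, dist_eq_norm, ← hy', UnitAddCircle.norm_eq]
  · have h : ((y - round y : ℝ) : UnitAddCircle) = x' - x := by
      rw [← hy', AddCircle.coe_sub, sub_eq_self]
      exact (AddCircle.coe_eq_zero_iff 1).2 ⟨round y, by simp⟩
    rw [h, add_sub_cancel]

/-- As `c ≤ f ≤ F`, the time of the `K`-th return is at most of order `1 / τ`, and the time spent on
the next `K'` returns is at least of that order. So `M` and `L` are comparable, and both are large
when `τ` is small. -/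
theorem exists_time_window (hc : 0 < c) (hf : ∀ x, c ≤ f x) {F : ℝ} (hF : ∀ x, f x ≤ F)
    {γ κ : ℝ} (hγ : 0 < γ) (hκ : 0 < κ) :
    ∃ κ' : ℝ, 0 < κ' ∧ ∀ N : ℕ, ∃ τ₀ : ℝ, 0 < τ₀ ∧ ∀ τ : ℝ, 0 < τ → τ < τ₀ →
      ∀ (K K' : ℕ), K * τ ≤ 1 → κ ≤ K * τ → κ ≤ K' * τ → ∀ q : Space f,
      ∃ M L : ℕ, N < M ∧ N < L ∧ κ' * M ≤ L ∧ ∀ n : ℕ, M ≤ n → n ≤ M + L →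
        cocycle (Equiv.addRight (α : UnitAddCircle)) f K q.1.1 ≤ q.1.2 + n * γ ∧
        q.1.2 + n * γ < cocycle (Equiv.addRight (α : UnitAddCircle)) f (K + K' : ℕ) q.1.1 := by
  have hF0 : 0 < F := hc.trans_le ((hf 0).trans (hF 0))
  set G := c * κ / (2 * γ) with hG
  have hG0 : 0 < G := by positivity
  refine ⟨G / (F / γ + 1), by positivity, fun N => ?_⟩
  refine ⟨min (min 1 (G / (F / γ + 2))) (G / (N + 1)), by positivity,
    fun τ hτ hττ K K' hK1 hK hK' q => ?_⟩
  have hτ1 : τ < 1 := hττ.trans_le ((min_le_left _ _).trans (min_le_left _ _))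
  have hτ2 : τ * (F / γ + 2) < G := (lt_div_iff₀ (by positivity)).1
    (hττ.trans_le ((min_le_left _ _).trans (min_le_right _ _)))
  have hτ3 : τ * (N + 1) < G := (lt_div_iff₀ (by positivity)).1 (hττ.trans_le (min_le_right _ _))
  set T := Equiv.addRight (α : UnitAddCircle) with hT
  set s := cocycle T f K q.1.1 with hs
  have hs1 : c * K ≤ s := le_cocycle_natCast hf K _
  have hs2 : s ≤ F * K := cocycle_natCast_le hF K _
  have hs3 : c * K' ≤ cocycle T f (K + K' : ℕ) q.1.1 - s := by
    have := mul_sub_le_cocycle_sub (T := T) hf (show (K : ℤ) ≤ (K + K' : ℕ) by push_cast; omega)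
      q.1.1
    push_cast at this ⊢
    linarith
  have hs0 : 0 ≤ s := le_trans (by positivity) hs1
  have hq := q.2
  have hqF := hF q.1.1
  set M := ⌈s / γ⌉₊ with hM
  -- `F` is reserved for the initial height of `q`, and one step `γ` for the ceiling in `M`.
  set L := ⌊(c * K' - F) / γ - 1⌋₊ with hL
  have hM1 : s ≤ M * γ := (div_le_iff₀ hγ).1 (Nat.le_ceil _)
  have hM2 : M * γ < s + γ := by
    have h1 : (M : ℝ) < s / γ + 1 := Nat.ceil_lt_add_one (by positivity)
    calc M * γ < (s / γ + 1) * γ := by gcongr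
      _ = s + γ := by field_simp
  have hGγ : 2 * G * γ = c * κ := by rw [hG]; field_simp
  have hLlow : G < L * τ := by
    have h1 : (c * K' - F) / γ - 1 < L + 1 := Nat.lt_floor_add_one _
    have h2 : c * K' / γ * τ < (L + (F / γ + 2)) * τ := by
      gcongr
      have : (c * K' - F) / γ = c * K' / γ - F / γ := by ring
      linarith
    have h3 : 2 * G ≤ c * K' / γ * τ := by
      rw [show c * K' / γ * τ = c * (K' * τ) / γ by ring, le_div_iff₀ hγ, hGγ]
      gcongr
    nlinarith
  have hMlow : G < M * τ := by
    have h1 : c * κ ≤ (M * τ) * γ := by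
      calc c * κ ≤ c * (K * τ) := by gcongr
        _ = c * K * τ := by ring
        _ ≤ (M * γ) * τ := by
            have := hs1.trans hM1
            gcongr
        _ = _ := by ring
    rw [← hGγ] at h1
    have := le_of_mul_le_mul_right h1 hγ
    linarith
  have hMup : M * τ ≤ F / γ + 1 := by
    have h1 : M * τ * γ ≤ (F / γ + 1) * γ := by
      calc M * τ * γ = (M * γ) * τ := by ring
        _ ≤ (F * K + γ) * τ := by
            have : M * γ ≤ F * K + γ := by linarith
            gcongr
        _ = F * (K * τ) + γ * τ := by ring
        _ ≤ F * 1 + γ * 1 := by gcongr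
        _ = _ := by field_simp
    exact le_of_mul_le_mul_right h1 hγ
  have hlarge : ∀ m : ℕ, G < m * τ → N < m := by
    intro m hm
    have h1 : τ * (N + 1) < m * τ := hτ3.trans hm
    have h2 : ((N : ℝ) + 1) < m := by
      refine lt_of_mul_lt_mul_right (a := τ) ?_ hτ.le
      linarith
    have : (N : ℝ) < m := by linarith
    exact_mod_cast this
  have hL0 : 0 < L := lt_of_le_of_lt (Nat.zero_le _) (hlarge L hLlow)
  have hLup : (L : ℝ) * γ ≤ c * K' - F - γ := by
    have h1 : (L : ℝ) ≤ (c * K' - F) / γ - 1 := Nat.floor_le (by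
      by_contra! h
      rw [hL, Nat.floor_of_nonpos h.le] at hL0
      exact lt_irrefl _ hL0)
    calc (L : ℝ) * γ ≤ ((c * K' - F) / γ - 1) * γ := by gcongr
      _ = _ := by field_simp
  refine ⟨M, L, hlarge M hMlow, hlarge L hLlow, ?_, fun n hn hn' => ⟨?_, ?_⟩⟩
  · refine le_of_mul_le_mul_right ?_ hτ
    calc G / (F / γ + 1) * M * τ = G / (F / γ + 1) * (M * τ) := by ring
      _ ≤ G / (F / γ + 1) * (F / γ + 1) := by gcongr
      _ = G := by field_simp
      _ ≤ L * τ := hLlow.le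
  · have h1 : (M : ℝ) ≤ n := by exact_mod_cast hn
    have h2 : (M : ℝ) * γ ≤ n * γ := by gcongr
    linarith [hq.1]
  · have h1 : (n : ℝ) ≤ M + L := by exact_mod_cast hn'
    have h2 : (n : ℝ) * γ ≤ (M + L) * γ := by gcongr
    have h3 := hq.2
    linarith

end Transfer

/-! ### The sums of jumps and the set of shifts -/

section JumpSums

variable {C : ℝ} {d : ℕ → ℝ} {α : ℝ}

/-- A bounded set of integers attains its supremum. Integrality makes `2C + 1` the exact number of
choices for each coefficient `n i`. -/
theorem exists_int_cfConst_eq (hα : Irrational α) (hb : BddAbove (Set.range (partialQuotient α))) :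
    ∃ z : ℤ, cfConst α = z := by
  have hint : ∀ n, ∃ z : ℤ, partialQuotient α n = z := by
    intro n
    obtain ⟨r, A', B', A, B, h0, hirr, hr0, hr1, -⟩ := exists_stream_contsAux hα n
    exact ⟨_, partialQuotient_eq_floor h0 hr0.ne'⟩
  choose z hz using hint
  obtain ⟨M, hM⟩ := hb
  obtain ⟨m, ⟨n, rfl⟩, hmax⟩ := Int.exists_greatest_of_bdd (P := fun m => ∃ n, z n = m)
    ⟨⌈M⌉, by
      rintro _ ⟨n, rfl⟩
      have h1 : (z n : ℝ) ≤ M := hz n ▸ hM ⟨n, rfl⟩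
      exact_mod_cast h1.trans (Int.le_ceil M)⟩ ⟨z 0, 0, rfl⟩
  refine ⟨z n + 1, ?_⟩
  have h2 : IsGreatest (Set.range (partialQuotient α)) (partialQuotient α n) := by
    refine ⟨⟨n, rfl⟩, ?_⟩
    rintro _ ⟨k, rfl⟩
    rw [hz, hz]
    exact_mod_cast hmax _ ⟨k, rfl⟩
  have h3 : ⨆ n, partialQuotient α n = z n := by rw [← hz]; exact h2.csSup_eq
  rw [cfConst, h3]
  push_cast
  rfl

theorem abs_le_of_mem_jumpSums (hd : Summable d) {r : ℝ} (hr : r ∈ jumpSums C d) :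
    |r| ≤ (2 * C + 1) * ∑' i, |d i| := by
  obtain ⟨n, hn, hs⟩ := hr
  rw [← hs.tsum_eq, ← tsum_mul_left, ← Real.norm_eq_abs]
  refine tsum_of_norm_bounded (hd.abs.mul_left _).hasSum fun i => ?_
  rw [Real.norm_eq_abs, abs_mul, Nat.abs_cast]
  exact mul_le_mul_of_nonneg_right (hn i).le (abs_nonneg _)

/-- The sums of jumps are close to the finitely many sums of the first jumps. -/
theorem exists_abs_sub_mem_of_mem_jumpSums (hd : Summable d) {Q : ℕ} (hQ : (Q : ℝ) = 2 * C + 1)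
    (j : ℕ) {r : ℝ} (hr : r ∈ jumpSums C d) : ∃ v : Fin j → Fin Q,
      r - ∑ i, ((v i : ℕ) : ℝ) * d i ∈
        Icc (-(Q * ∑' i, max (-d (i + j)) 0)) (Q * ∑' i, max (d (i + j)) 0) := by
  obtain ⟨n, hn, hs⟩ := hr
  have hnQ : ∀ i, n i < Q := by
    intro i
    have := hn i
    rw [← hQ] at this
    exact_mod_cast this
  refine ⟨fun i => ⟨n i, hnQ i⟩, ?_⟩
  have h1 := hs.summable.sum_add_tsum_nat_add j
  rw [hs.tsum_eq, ← Fin.sum_univ_eq_sum_range fun i => (n i : ℝ) * d i] at h1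
  have hd' : Summable fun i => |d (i + j)| := (summable_nat_add_iff j).2 hd.abs
  have hsp : Summable fun i => max (d (i + j)) 0 :=
    Summable.of_nonneg_of_le (fun i => le_max_right _ _)
      (fun i => max_le (le_abs_self _) (abs_nonneg _)) hd'
  have hsm : Summable fun i => max (-d (i + j)) 0 :=
    Summable.of_nonneg_of_le (fun i => le_max_right _ _)
      (fun i => max_le (neg_le_abs _) (abs_nonneg _)) hd'
  have hsn : Summable fun i => (n (i + j) : ℝ) * d (i + j) := (summable_nat_add_iff j).2 hs.summable
  have h2 : r - ∑ i : Fin j, (n i : ℝ) * d i = ∑' i, (n (i + j) : ℝ) * d (i + j) := by linarith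
  have hnR : ∀ i, (n i : ℝ) ≤ Q := fun i => by exact_mod_cast (hnQ i).le
  change r - ∑ i : Fin j, (n i : ℝ) * d i ∈ _
  rw [h2]
  constructor
  · rw [← tsum_mul_left, ← tsum_neg]
    refine Summable.tsum_le_tsum (fun i => ?_) (hsm.mul_left _).neg hsn
    have h3 : -max (-d (i + j)) 0 ≤ d (i + j) := by linarith [le_max_left (-d (i + j)) 0]
    have h4 : (n (i + j) : ℝ) * max (-d (i + j)) 0 ≤ Q * max (-d (i + j)) 0 :=
      mul_le_mul_of_nonneg_right (hnR _) (le_max_right _ _)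
    have h5 := mul_le_mul_of_nonneg_left h3 (Nat.cast_nonneg (α := ℝ) (n (i + j)))
    linarith
  · rw [← tsum_mul_left]
    refine Summable.tsum_le_tsum (fun i => ?_) hsn (hsp.mul_left _)
    calc (n (i + j) : ℝ) * d (i + j) ≤ n (i + j) * max (d (i + j)) 0 := by
          gcongr
          exact le_max_left _ _
      _ ≤ _ := mul_le_mul_of_nonneg_right (hnR _) (le_max_right _ _)

/-- The first `j` coefficients take `Q ^ j` values; the others move the sum within an interval of
length `Q` times the tail. Doubling for `-D`, the total length is below `|S|`, and the complement of
this closed cover is open. -/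
theorem exists_Ioo_subset_diff_jumpSums (hd : Summable d) {Q : ℕ} (hQ : (Q : ℝ) = 2 * C + 1)
    (hQ0 : 0 < Q) {S θ : ℝ} (hS : S ≠ 0) (hθ : 0 < θ) (j : ℕ)
    (htail : ∑' i, |d (i + j)| ≤ |S| / ((2 + θ) * (2 * C + 1) * ((2 * C + 1) ^ j + 1))) :
    ∃ p η : ℝ, 0 < η ∧
      Set.Ioo (p - η) (p + η) ⊆ Set.Ioo 0 |S| \ (jumpSums C d ∪ -jumpSums C d) := by
  have hS0 : 0 < |S| := abs_pos.2 hS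
  have hQ0' : (0 : ℝ) < Q := by exact_mod_cast hQ0
  have hd' : Summable fun i => |d (i + j)| := (summable_nat_add_iff j).2 hd.abs
  -- Separating the signs gives intervals of length `Q (tp + tm)`, half of what the symmetric bound
  -- would give.
  set tp := ∑' i, max (d (i + j)) 0 with htp
  set tm := ∑' i, max (-d (i + j)) 0 with htm
  have htp0 : 0 ≤ tp := tsum_nonneg fun i => le_max_right _ _
  have htm0 : 0 ≤ tm := tsum_nonneg fun i => le_max_right _ _
  have hsum : tp + tm = ∑' i, |d (i + j)| := by
    have hsp : Summable fun i => max (d (i + j)) 0 :=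
      Summable.of_nonneg_of_le (fun i => le_max_right _ _)
        (fun i => max_le (le_abs_self _) (abs_nonneg _)) hd'
    have hsm : Summable fun i => max (-d (i + j)) 0 :=
      Summable.of_nonneg_of_le (fun i => le_max_right _ _)
        (fun i => max_le (neg_le_abs _) (abs_nonneg _)) hd'
    rw [htp, htm, ← hsp.tsum_add hsm]
    refine tsum_congr fun i => ?_
    rcases le_total 0 (d (i + j)) with h | h
    · rw [abs_of_nonneg h, max_eq_left h, max_eq_right (by linarith), add_zero]
    · rw [abs_of_nonpos h, max_eq_right h, max_eq_left (by linarith), zero_add]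
  set ctr : (Fin j → Fin Q) → ℝ := fun v => ∑ i, ((v i : ℕ) : ℝ) * d i with hctr
  set U : Set ℝ := ⋃ v, (Icc (ctr v - Q * tm) (ctr v + Q * tp) ∪
    Icc (-(ctr v + Q * tp)) (-(ctr v - Q * tm))) with hU
  have hDU : jumpSums C d ∪ -jumpSums C d ⊆ U := by
    rintro r (hr | hr)
    · obtain ⟨v, hv⟩ := exists_abs_sub_mem_of_mem_jumpSums hd hQ j hr
      refine mem_iUnion.2 ⟨v, Or.inl ?_⟩
      constructor <;> linarith [hv.1, hv.2]
    · obtain ⟨v, hv⟩ := exists_abs_sub_mem_of_mem_jumpSums hd hQ j hr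
      refine mem_iUnion.2 ⟨v, Or.inr ?_⟩
      constructor <;> linarith [hv.1, hv.2]
  have hUc : IsClosed U := isClosed_iUnion_of_finite fun v => isClosed_Icc.union isClosed_Icc
  have hUvol : volume U < ENNReal.ofReal |S| := by
    have h1 : ∀ v, volume (Icc (ctr v - Q * tm) (ctr v + Q * tp) ∪
        Icc (-(ctr v + Q * tp)) (-(ctr v - Q * tm))) ≤ ENNReal.ofReal (2 * (Q * (tp + tm))) := by
      intro v
      refine (measure_union_le _ _).trans ?_
      have h2 : 0 ≤ (Q : ℝ) * tp := by positivity
      have h3 : 0 ≤ (Q : ℝ) * tm := by positivity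
      rw [Real.volume_Icc, Real.volume_Icc, ← ENNReal.ofReal_add (by linarith) (by linarith)]
      exact ENNReal.ofReal_le_ofReal (by linarith)
    have h4 : volume U ≤ ENNReal.ofReal ((Q : ℝ) ^ j * (2 * (Q * (tp + tm)))) := by
      refine (measure_iUnion_le _).trans ?_
      rw [tsum_fintype]
      refine (Finset.sum_le_sum fun v _ => h1 v).trans ?_
      rw [Finset.sum_const, Finset.card_univ, Fintype.card_fun, Fintype.card_fin, Fintype.card_fin,
        nsmul_eq_mul, ENNReal.ofReal_mul (p := (Q : ℝ) ^ j) (by positivity),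
        ← Nat.cast_pow, ENNReal.ofReal_natCast]
    refine h4.trans_lt ((ENNReal.ofReal_lt_ofReal_iff hS0).2 ?_)
    rw [hsum]
    rw [← hQ, le_div_iff₀ (by positivity)] at htail
    have h5 : 0 ≤ ∑' i, |d (i + j)| := tsum_nonneg fun i => abs_nonneg _
    set t := ∑' i, |d (i + j)|
    have h6 : 0 ≤ t * Q := by positivity
    have h7 : 0 ≤ t * Q * (Q : ℝ) ^ j := by positivity
    have h8 : t * ((2 + θ) * Q * ((Q : ℝ) ^ j + 1)) =
        2 * (t * Q * (Q : ℝ) ^ j) + 2 * (t * Q) + θ * (t * Q * (Q : ℝ) ^ j) + θ * (t * Q) := by ring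
    have h9 : 0 ≤ θ * (t * Q * (Q : ℝ) ^ j) := by positivity
    -- Strictness comes from the `+ 1` next to `Q ^ j`, provided that the tail is nonzero.
    rcases h6.eq_or_lt with h10 | h10
    · rw [show (Q : ℝ) ^ j * (2 * (Q * t)) = 2 * (t * Q) * (Q : ℝ) ^ j by ring, ← h10]
      simpa using hS0
    · have h11 : 0 ≤ θ * (t * Q) := by positivity
      rw [show (Q : ℝ) ^ j * (2 * (Q * t)) = 2 * (t * Q * (Q : ℝ) ^ j) by ring]
      linarith
  obtain ⟨p, hp, hpU⟩ : ∃ p ∈ Ioo (0 : ℝ) |S|, p ∉ U := by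
    by_contra! h
    have h1 := measure_mono (μ := volume) h
    rw [Real.volume_Ioo, sub_zero] at h1
    exact absurd hUvol (not_lt.2 h1)
  obtain ⟨η, hη, hball⟩ := Metric.isOpen_iff.1 (isOpen_Ioo.sdiff hUc) p ⟨hp, hpU⟩
  refine ⟨p, η, hη, ?_⟩
  rw [← Real.ball_eq_Ioo]
  exact hball.trans (sdiff_subset_sdiff_right hDU)

theorem isCompact_shiftSet (hd : Summable d) (S p : ℝ) :
    IsCompact (shiftSet S p (jumpSums C d)) := by
  refine Metric.isCompact_of_isClosed_isBounded isClosed_closure (Bornology.IsBounded.closure ?_)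
  refine (Metric.isBounded_iff_subset_closedBall 0).2
    ⟨|Real.sign S * p| + (2 * C + 1) * ∑' i, |d i|, ?_⟩
  rintro _ ⟨r, hr, rfl⟩
  rw [mem_closedBall_zero_iff, Real.norm_eq_abs]
  refine (abs_sub _ _).trans ?_
  have := abs_le_of_mem_jumpSums hd hr
  linarith

/-- An element within `η` of `0` would put `r` (if `S > 0`) or `-r` (if `S < 0`) within `η` of `p`;
hence the gap must avoid both `D` and `-D`. -/
theorem zero_notMem_shiftSet {S p η : ℝ} {D : Set ℝ} (hS : S ≠ 0) (hη : 0 < η)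
    (h : Set.Ioo (p - η) (p + η) ⊆ Set.Ioo 0 |S| \ (D ∪ -D)) : (0 : ℝ) ∉ shiftSet S p D := by
  intro h0
  obtain ⟨_, ⟨r, hr, rfl⟩, hlt⟩ := Metric.mem_closure_iff.1 h0 η hη
  rw [dist_comm, Real.dist_eq, sub_zero] at hlt
  rcases lt_or_gt_of_ne hS with hneg | hpos
  · rw [Real.sign_of_neg hneg] at hlt
    have h1 := abs_lt.1 hlt
    exact (h (a := -r) ⟨by linarith [h1.1, h1.2], by linarith [h1.1, h1.2]⟩).2
      (Or.inr (by simpa using hr))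
  · rw [Real.sign_of_pos hpos] at hlt
    have h1 := abs_lt.1 hlt
    exact (h (a := r) ⟨by linarith [h1.1, h1.2], by linarith [h1.1, h1.2]⟩).2 (Or.inl hr)

end JumpSums

/-! ### Assembling the property `R(γ, P ∪ -P)` -/

section Ratner

variable {f : UnitAddCircle → ℝ} {β : ℕ → ℝ} {d : ℕ → ℝ} {α C : ℝ}

/-- The window statement for two nearby points of the circle. -/
theorem exists_window_shift (hf : MemV f) (hβ : ListsDiscontinuities f β)
    (hd : ∀ i, d i = jump f (β i)) (hS : sumJumps f ≠ 0) (hαi : Irrational α) (hC : 0 < C)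
    (hα : ∀ m : ℕ, 0 < m → ∀ k : ℤ, 1 ≤ 2 * C * m * |m * α - k|) {p : ℝ} (hp : 0 < p)
    (hpS : p ≤ |sumJumps f|) {ξ : ℝ} (hξ : 0 < ξ) :
    ∃ κ τ₀ : ℝ, 0 < κ ∧ 0 < τ₀ ∧ ∀ x x' : UnitAddCircle, x ≠ x' → dist x x' < τ₀ →
      ∃ (K K' : ℕ), ∃ ρ ∈ shiftSet (sumJumps f) p (jumpSums C d) ∪
          -shiftSet (sumJumps f) p (jumpSums C d),
        K * dist x x' ≤ 1 ∧ κ ≤ K * dist x x' ∧ κ ≤ K' * dist x x' ∧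
        ∀ k : ℕ, K ≤ k → k ≤ K + K' →
          |cocycle (Equiv.addRight (α : UnitAddCircle)) f k x' -
            cocycle (Equiv.addRight (α : UnitAddCircle)) f k x - ρ| ≤ ξ := by
  obtain ⟨κ, τ₀, hκ, hτ₀, H⟩ := exists_window_cocycle_sub hf hβ hd hS hαi
    (show 0 < 2 * C by linarith) hα hp hpS hξ
  refine ⟨κ, τ₀, hκ, hτ₀, fun x x' hne hlt => ?_⟩
  obtain ⟨t, ht, hx'⟩ := exists_abs_eq_dist x x'
  have hpos : 0 < dist x x' := dist_pos.2 hne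
  rw [← ht] at hpos hlt ⊢
  obtain ⟨a, ha⟩ := QuotientAddGroup.mk_surjective x
  have ha' : (a : UnitAddCircle) = x := ha
  rcases lt_or_gt_of_ne (abs_pos.1 hpos) with h | h
  -- Here the arc starts at `x'`: the points exchange roles and the shift changes sign, which is why
  -- `-P` is needed.
  · obtain ⟨K, K', n, r, hn, hr, h1, h2, h3, h4⟩ := H |t| hpos hlt (a + t)
    refine ⟨K, K', -(Real.sign (sumJumps f) * p - r), Or.inr ?_, h1, h2, h3, fun k hk hk' => ?_⟩
    · rw [Set.mem_neg, neg_neg]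
      exact subset_closure ⟨r, ⟨n, hn, hr⟩, rfl⟩
    · have h5 := h4 k hk hk'
      have h6 : ((a + t + |t| : ℝ) : UnitAddCircle) = x := by
        rw [abs_of_neg h, add_neg_cancel_right, ha']
      have h7 : ((a + t : ℝ) : UnitAddCircle) = x' := by rw [hx', ← ha']; rfl
      rw [h6, h7] at h5
      rw [← abs_neg]
      convert h5 using 2
      ring
  · obtain ⟨K, K', n, r, hn, hr, h1, h2, h3, h4⟩ := H |t| hpos hlt a
    refine ⟨K, K', Real.sign (sumJumps f) * p - r,
      Or.inl (subset_closure ⟨r, ⟨n, hn, hr⟩, rfl⟩), h1, h2, h3, fun k hk hk' => ?_⟩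
    have h5 := h4 k hk hk'
    have h6 : ((a + |t| : ℝ) : UnitAddCircle) = x' := by
      rw [abs_of_pos h, hx', ← ha']
      rfl
    rwa [h6, ha'] at h5

/-- The order of choices matters: `ε` determines the boundary width `w`, then `κ'`, `Z` and `N₀`;
only the distance bound depends on `N`. -/
theorem ratnerProperty_specialFlow (hf : MemV f) {c : ℝ} (hc : 0 < c) (hfc : ∀ x, c ≤ f x)
    (hβ : ListsDiscontinuities f β)
    (hd : ∀ i, d i = jump f (β i)) (hS : sumJumps f ≠ 0) (hαi : Irrational α) (hC : 0 < C)
    (hα : ∀ m : ℕ, 0 < m → ∀ k : ℤ, 1 ≤ 2 * C * m * |m * α - k|) {p η : ℝ} (hη : 0 < η)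
    (hp : Set.Ioo (p - η) (p + η) ⊆
      Set.Ioo 0 |sumJumps f| \ (jumpSums C d ∪ -jumpSums C d)) {γ : ℝ} (hγ : 0 < γ) :
    RatnerProperty (specialFlow (Equiv.addRight (α : UnitAddCircle)) f) (flowMeasure f) γ
      (shiftSet (sumJumps f) p (jumpSums C d) ∪ -shiftSet (sumJumps f) p (jumpSums C d)) := by
  have hds := summable_of_jumps hβ hd hS
  have hcomp := isCompact_shiftSet (C := C) hds (sumJumps f) p
  have h0 := zero_notMem_shiftSet hS hη hp
  refine ⟨hγ.ne', hcomp.union hcomp.neg, ?_, fun ε hε => ?_⟩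
  · rintro (h | h)
    · exact h0 h
    · rw [Set.mem_neg, neg_zero] at h
      exact h0 h
  have hpmem := (hp (a := p) ⟨by linarith, by linarith⟩).1
  have hfm := measurable_roof hf
  obtain ⟨F, hF⟩ := exists_roof_le hf
  set T := Equiv.addRight (α : UnitAddCircle) with hT
  have : IsProbabilityMeasure (volume : Measure UnitAddCircle) := ⟨UnitAddCircle.measure_univ⟩
  have := isProbabilityMeasure_flowMeasure hfm hc hfc hF
  have hTm : ∀ n : ℤ, MeasurePreserving (T ^ n : Equiv.Perm UnitAddCircle) := by
    intro n
    have h1 : ⇑(T ^ n : Equiv.Perm UnitAddCircle) = fun x => x + n • (α : UnitAddCircle) :=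
      funext fun x => addRight_zpow_apply _ _ _
    rw [h1]
    exact measurePreserving_add_right volume _
  have hmp : MeasurePreserving (specialFlow T f γ) (flowMeasure f) (flowMeasure f) :=
    (measurePreserving_specialFlow hTm hfm hc hfc γ).smul_measure _
  -- Capping at `1` makes the measure of `Z` positive even when `ε > 1`.
  set ε₁ := min ε 1 with hε₁
  have hε₁0 : 0 < ε₁ := by positivity
  -- Turns the boundary measure bound `2 w / c` into the `ε₁ ^ 2 / 32` needed for rare visits.
  set w := min ε₁ (c * ε₁ ^ 2 / 64) with hw
  have hw0 : 0 < w := by positivity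
  have hwε : w ≤ ε := (min_le_left _ _).trans (min_le_left _ _)
  have hμB : (flowMeasure f).real (nearBoundary f w) ≤ ε₁ ^ 2 / 32 := by
    refine (flowMeasure_real_nearBoundary_le hfm hc hfc hw0.le).trans ?_
    rw [div_le_iff₀ hc]
    have := min_le_right ε₁ (c * ε₁ ^ 2 / 64)
    linarith
  obtain ⟨κ, τ₀, hκ, hτ₀, hwin⟩ := exists_window_shift hf hβ hd hS hαi hC hα hpmem.1 hpmem.2.le
    (show 0 < w / 4 by positivity)
  obtain ⟨κ', hκ', htime⟩ := exists_time_window (α := α) hc hfc hF hγ hκ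
  obtain ⟨Z, N₀, hZm, hZμ, hZ⟩ := exists_birkhoffSum_indicator_le hmp
    (measurableSet_nearBoundary hfm) hε₁0 hμB hκ'
  refine ⟨κ', hκ', fun N => ?_⟩
  obtain ⟨τ₁, hτ₁, htime⟩ := htime (N + N₀)
  refine ⟨min (min τ₀ τ₁) (w / 4), by positivity, Z, hZm, ?_, fun q hq q' hq' horb hdist => ?_⟩
  · rw [probReal_compl_eq_one_sub hZm] at hZμ
    rw [← ofReal_measureReal (measure_ne_top _ _)]
    have h1 : ε₁ ≤ ε := min_le_left _ _
    have h2 : ε₁ ≤ 1 := min_le_right _ _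
    exact (ENNReal.ofReal_lt_ofReal_iff (by linarith)).2 (by linarith)
  · have hne : q.1.1 ≠ q'.1.1 := fun h => horb _ (specialFlow_sub_of_base_eq hc hfc h)
    have hle : dist q.1.1 q'.1.1 ≤ dist q q' := le_add_of_nonneg_right (abs_nonneg _)
    have hd0 : dist q.1.1 q'.1.1 < τ₀ :=
      (hle.trans_lt hdist).trans_le ((min_le_left _ _).trans (min_le_left _ _))
    have hd1 : dist q.1.1 q'.1.1 < τ₁ :=
      (hle.trans_lt hdist).trans_le ((min_le_left _ _).trans (min_le_right _ _))
    obtain ⟨K, K', ρ, hρ, hK1, hK2, hK3, hK⟩ := hwin _ _ hne hd0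
    obtain ⟨M, L, hM, hL, hML, hwindow⟩ :=
      htime _ (dist_pos.2 hne) hd1 K K' hK1 hK2 hK3 q
    refine ⟨M, L, by omega, by omega, by omega, by omega, ?_, ρ, hρ, ?_⟩
    · rw [le_div_iff₀ (by exact_mod_cast (by omega : 0 < M))]
      exact hML
    · refine lt_ncard_of_birkhoffSum_le (U := specialFlow T f γ) (B := nearBoundary f w) (q := q)
        (by omega) ((hZ q hq M L (by omega) hML).trans (by gcongr; exact min_le_left _ _))
        fun n hn hn' hB => ?_
      rw [← specialFlow_natCast_mul hc hfc] at hB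
      obtain ⟨h1, h2⟩ := hwindow n hn hn'
      simp only [Int.cast_natCast]
      exact (dist_specialFlow_lt hc hfc (hdist.trans_le (min_le_right _ _)) hK h1 h2 hB).trans_le hwε

end Ratner

end SpecialFlowRatner

end

/-! ### The theorem -/

theorem mainTheorem2
    (α : ℝ) (hα : Irrational α)
    (hbpq : BddAbove (Set.range (SpecialFlowRatner.partialQuotient α)))
    (f : UnitAddCircle → ℝ) (hfU : SpecialFlowRatner.MemU f)
    (hfpos : ∃ c : ℝ, 0 < c ∧ ∀ x, c ≤ f x)
    (β : ℕ → ℝ) (hβ : SpecialFlowRatner.ListsDiscontinuities f β)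
    (d : ℕ → ℝ) (hd : ∀ i, d i = SpecialFlowRatner.jump f (β i))
    (C S : ℝ) (hC : C = SpecialFlowRatner.cfConst α) (hS : S = SpecialFlowRatner.sumJumps f)
    (j : ℕ) (θ : ℝ) (hθ : 0 < θ)
    (htail : ∑' i, |d (i + j)| ≤ |S| / ((2 + θ) * (2 * C + 1) * ((2 * C + 1) ^ j + 1)))
    (D : Set ℝ) (hD : D = SpecialFlowRatner.jumpSums C d) :
    (∃ p η : ℝ, 0 < η ∧ Set.Ioo (p - η) (p + η) ⊆ Set.Ioo 0 |S| \ (D ∪ -D)) ∧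
    ∀ p η : ℝ, 0 < η → Set.Ioo (p - η) (p + η) ⊆ Set.Ioo 0 |S| \ (D ∪ -D) →
      ∀ γ : ℝ, 0 < γ →
        SpecialFlowRatner.RatnerProperty
          (SpecialFlowRatner.specialFlow (Equiv.addRight (α : UnitAddCircle)) f)
          (SpecialFlowRatner.flowMeasure f) γ
          (SpecialFlowRatner.shiftSet S p D ∪ -SpecialFlowRatner.shiftSet S p D) := by
  obtain ⟨hfV, hS0⟩ := hfU
  obtain ⟨c, hc, hfc⟩ := hfpos
  subst hS hC hD
  have hC2 := SpecialFlowRatner.two_le_cfConst hα hbpq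
  refine ⟨?_, fun p η hη hp γ hγ => ?_⟩
  · obtain ⟨z, hz⟩ := SpecialFlowRatner.exists_int_cfConst_eq hα hbpq
    have hz2 : (2 : ℤ) ≤ z := by
      rw [hz] at hC2
      exact_mod_cast hC2
    have hQ : (((2 * z + 1).toNat : ℕ) : ℝ) = 2 * SpecialFlowRatner.cfConst α + 1 := by
      have h1 : (((2 * z + 1).toNat : ℕ) : ℤ) = 2 * z + 1 := Int.toNat_of_nonneg (by omega)
      rw [hz]
      exact_mod_cast h1
    exact SpecialFlowRatner.exists_Ioo_subset_diff_jumpSums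
      (SpecialFlowRatner.summable_of_jumps hβ hd hS0) hQ (by omega) hS0 hθ j htail
  · exact SpecialFlowRatner.ratnerProperty_specialFlow hfV hc hfc hβ hd hS0 hα (by linarith)
      (fun m hm k => SpecialFlowRatner.one_le_mul_abs_sub hα hbpq hm k) hη hp hγ
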